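/- **Conventions.** Let $k$ be a field. For $\mathbf d\in\mathbb Z^n$ put $\deg(\mathbf d)=d_1+\cdots+d_n$. A function $f\colon\mathbb Z^n\to\mathbb Z$ is a *Riemann function* if for some $C,a,b\in\mathbb Z$ we have $f(\mathbf d)=0$ whenever $\deg(\mathbf d)\le a$ and $f(\mathbf d)=\deg(\mathbf d)+C$ whenever $\deg(\mathbf d)\ge b$. For distinct $i,j\in[n]$ and $\mathbf d\in\mathbb Z^n$ let $f_{i,j,\mathbf d}(a_i,a_j)=f(\mathbf d+a_i\mathbf e_i+a_j\mathbf e_j)$, and let $W_{f;i,j,\mathbf d}\colon\mathbb Z^2\to\mathbb Z$ be its *weight*, i.e. the unique function $W$ that vanishes in all sufficiently small degrees and satisfies $f_{i,j,\mathbf d}(\mathbf a)=\sum_{\mathbf a'\le\mathbf a}W(\mathbf a')$ for all $\mathbf a\in\mathbb Z^2$. A *$k$-diagram* $\mathcal F$ consists of $k$-vector spaces $\mathcal F(B_1),\mathcal F(B_2),\mathcal F(B_3),\mathcal F(A_1),\mathcal F(A_2)$ and linear maps $\rho_{ij}\colon\mathcal F(B_i)\to\mathcal F(A_j)$ for $(i,j)\in\{(1,1),(2,2),(3,1),(3,2)\}$.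 Isomorphisms and direct sums are taken value by value. $\mathcal F$ is *Fredholm* if the map $(b_1,b_2,b_3)\mapsto(\rho_{11}b_1-\rho_{31}b_3,\ \rho_{22}b_2-\rho_{32}b_3)$ has finite-dimensional kernel and cokernel. A *virtual $k$-diagram* is a pair $\mathcal F_1\ominus\mathcal F_2$ of Fredholm $k$-diagrams; $\mathcal F_1\ominus\mathcal F_2$ and $\mathcal F_1'\ominus\mathcal F_2'$ are *equivalent* if $\mathcal F_1\oplus\mathcal F_2'\oplus\mathcal F_0\simeq\mathcal F_1'\oplus\mathcal F_2\oplus\mathcal F_0$ for some Fredholm $k$-diagram $\mathcal F_0$. A *perfect matching* is a function $W\colon\mathbb Z^2\to\mathbb Z$, vanishing in all sufficiently small and all sufficiently large degrees, such that for some bijection $\pi\colon\mathbb Z\to\mathbb Z$ we have $W(a_1,a_2)=1$ if $a_2=\pi(a_1)$ and $W(a_1,a_2)=0$ otherwise. For such $W$ and $\mathbf d\in\mathbb Z^2$, $\mathcal M_{W,\mathbf d}$ is the $k$-diagram with $\mathcal M_{W,\mathbf d}(B_i)=k^{\oplus\mathbb Z_{\le d_i}}$ and $\mathcal M_{W,\mathbf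 d}(A_i)=k^{\oplus\mathbb Z}$ for $i=1,2$, with $\mathcal M_{W,\mathbf d}(B_3)=k^{\oplus\{\mathbf a\,:\,W(\mathbf a)=1\}}$, with $\rho_{11},\rho_{22}$ the inclusions, and with $\rho_{3j}(\mathbf e_{(a_1,a_2)})=\mathbf e_{a_j}$. If $W\colon\mathbb Z^2\to\mathbb Z$ can be written as $$W=(W_1+\cdots+W_s)-(\tilde W_1+\cdots+\tilde W_{s-1})\qquad(*)$$ with $s\ge1$ and perfect matchings $W_r,\tilde W_r$, then $[\mathcal M_{W,\mathbf d}]$ denotes the equivalence class of the virtual $k$-diagram $\bigl(\bigoplus_{r=1}^s\mathcal M_{W_r,\mathbf d}\bigr)\ominus\bigl(\bigoplus_{r=1}^{s-1}\mathcal M_{\tilde W_r,\mathbf d}\bigr)$. Put $[\mathcal M_{f;i,j,\mathbf d}]=[\mathcal M_{W_{f;i,j,\mathbf d},\mathbf 0}]$. **Theorem.** Let $f\colon\mathbb Z^n\to\mathbb Z$ be a Riemann function and $\mathbf d\in\mathbb Z^n$. 1. For distinct $i,j\in[n]$, the weight $W_{f;i,j,\mathbf d}$ can be written as in $(*)$ if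 and only if it is bounded; in that case the direct sums in the definition of $[\mathcal M_{f;i,j,\mathbf d}]$ are Fredholm, and the class $[\mathcal M_{f;i,j,\mathbf d}]$ does not depend on the choice of $(*)$. 2. If $n\ge3$ and $i,j,j'\in[n]$ are distinct, and $W_{f;i,j,\mathbf d}$ and $W_{f;i,j',\mathbf d}$ are bounded, then $[\mathcal M_{f;i,j,\mathbf d}]=[\mathcal M_{f;i,j',\mathbf d}]$. 3. If $n\ge2$, the class $[\mathcal M_{f;i,j,\mathbf d}]$ is independent of the choice of distinct $i,j\in[n]$: for $i\ne j$ and $i'\ne j'$ in $[n]$ such that $W_{f;i,j,\mathbf d}$ and $W_{f;i',j',\mathbf d}$ are bounded, $[\mathcal M_{f;i,j,\mathbf d}]=[\mathcal M_{f;i',j',\mathbf d}]$. -/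

import Mathlib

universe u

/-! ### Riemann functions and weights -/

/-- The degree of an integer vector. -/
def vecDeg {n : ℕ} (d : Fin n → ℤ) : ℤ := ∑ i, d i

/-- `f : ℤⁿ → ℤ` is a Riemann function: it vanishes in small degree and equals `deg + C` in
large degree. -/
def IsRiemann {n : ℕ} (f : (Fin n → ℤ) → ℤ) : Prop :=
  ∃ C a b : ℤ, (∀ d, vecDeg d ≤ a → f d = 0) ∧ (∀ d, b ≤ vecDeg d → f d = vecDeg d + C)

/-- The two-variable restriction `f_{i,j,d}(a_i, a_j) = f(d + a_i e_i + a_j e_j)`. -/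
def twoVar {n : ℕ} (f : (Fin n → ℤ) → ℤ) (i j : Fin n) (d : Fin n → ℤ) : ℤ × ℤ → ℤ :=
  fun p => f (d + Pi.single i p.1 + Pi.single j p.2)

/-- `W : ℤ² → ℤ` vanishes in sufficiently small degree. -/
def InitiallyZero (W : ℤ × ℤ → ℤ) : Prop := ∃ a : ℤ, ∀ p, p.1 + p.2 ≤ a → W p = 0

/-- `W : ℤ² → ℤ` vanishes in sufficiently large degree. -/
def EventuallyZero (W : ℤ × ℤ → ℤ) : Prop := ∃ b : ℤ, ∀ p, b ≤ p.1 + p.2 → W p = 0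

/-- The weight of an (initially zero) function `g : ℤ² → ℤ`, given by Möbius inversion. By
`isWeight_iff` below it is the unique initially zero `W` with `g d = ∑_{d' ≤ d} W d'`. -/
def weight (g : ℤ × ℤ → ℤ) : ℤ × ℤ → ℤ :=
  fun p => g p - g (p.1 - 1, p.2) - g (p.1, p.2 - 1) + g (p.1 - 1, p.2 - 1)

/-- `W` is initially zero and `g d = ∑_{d' ≤ d} W d'` (a sum with finitely many nonzero terms). -/
def IsWeight (g W : ℤ × ℤ → ℤ) : Prop :=
  InitiallyZero W ∧ ∀ d, g d = ∑ᶠ d' ∈ Set.Iic d, W d'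

theorem finite_Iic_inter_support {W : ℤ × ℤ → ℤ} (hW : InitiallyZero W) (d : ℤ × ℤ) :
    (Set.Iic d ∩ Function.support W).Finite := by
  obtain ⟨a, ha⟩ := hW
  refine (Set.finite_Icc ((a - d.2, a - d.1) : ℤ × ℤ) d).subset ?_
  rintro p ⟨hp, hp'⟩
  have h1 : a < p.1 + p.2 := by
    by_contra h
    exact hp' (ha p (not_lt.mp h))
  have h2 : p.1 ≤ d.1 := hp.1
  have h3 : p.2 ≤ d.2 := hp.2
  refine ⟨⟨?_, ?_⟩, hp⟩ <;> simp only <;> omega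

theorem weight_finsum {W : ℤ × ℤ → ℤ} (hW : InitiallyZero W) :
    weight (fun d => ∑ᶠ d' ∈ Set.Iic d, W d') = W := by
  have fin : ∀ (d : ℤ × ℤ) (s : Set (ℤ × ℤ)), s ⊆ Set.Iic d → (s ∩ Function.support W).Finite :=
    fun d s hs => (finite_Iic_inter_support hW d).subset (Set.inter_subset_inter_left _ hs)
  let R : ℤ → ℤ → Set (ℤ × ℤ) := fun x y => {p | p.1 = x ∧ p.2 ≤ y}
  have hR : ∀ x y, R x y ⊆ Set.Iic (x, y) := fun x y p hp => ⟨hp.1.le, hp.2⟩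
  have h1 : ∀ x y, ∑ᶠ p ∈ Set.Iic (x, y), W p =
      ∑ᶠ p ∈ Set.Iic (x - 1, y), W p + ∑ᶠ p ∈ R x y, W p := by
    intro x y
    rw [← finsum_mem_union']
    · congr! 3 with p
      simp only [R, Set.mem_Iic, Set.mem_union, Set.mem_ofPred_eq, Prod.le_def]
      omega
    · rw [Set.disjoint_left]
      intro p hp hp'
      have := hp.1
      have := hp'.1
      simp only at *
      omega
    · exact fin _ _ le_rfl
    · exact fin _ _ (hR x y)
  have h2 : ∀ x y, ∑ᶠ p ∈ R x y, W p = ∑ᶠ p ∈ R x (y - 1), W p + W (x, y) := by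
    intro x y
    rw [← finsum_mem_singleton (f := W) (a := (x, y)), ← finsum_mem_union']
    · congr! 3 with p
      simp only [R, Set.mem_singleton_iff, Set.mem_union, Set.mem_ofPred_eq, Prod.ext_iff]
      omega
    · rw [Set.disjoint_left]
      intro p hp hp'
      have := hp.2
      rw [Set.mem_singleton_iff] at hp'
      subst hp'
      simp only at *
      omega
    · exact fin _ _ (hR x (y - 1))
    · exact (Set.finite_singleton _).inter_of_left _
  funext ⟨x, y⟩
  simp only [weight]
  rw [h1 x y, h1 x (y - 1), h2 x y]
  ring

theorem eq_zero_of_weight_eq_zero {h : ℤ × ℤ → ℤ} (h0 : InitiallyZero h)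
    (hw : ∀ p, weight h p = 0) (p : ℤ × ℤ) : h p = 0 := by
  obtain ⟨a, ha⟩ := h0
  have key : ∀ N : ℕ, ∀ p : ℤ × ℤ, p.1 + p.2 ≤ a + N → h p = 0 := by
    intro N
    induction N with
    | zero => intro p hp; exact ha p (by simpa using hp)
    | succ N ih =>
      intro p hp
      push_cast at hp
      have e := hw p
      simp only [weight] at e
      rw [ih (p.1 - 1, p.2) (by simp only; omega), ih (p.1, p.2 - 1) (by simp only; omega),
        ih (p.1 - 1, p.2 - 1) (by simp only; omega)] at e
      simpa using e
  exact key (p.1 + p.2 - a).toNat p (by omega)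

/-- The weight of an initially zero `g` is the unique initially zero `W` with
`g d = ∑_{d' ≤ d} W d'`. -/
theorem isWeight_iff {g : ℤ × ℤ → ℤ} (hg : InitiallyZero g) (W : ℤ × ℤ → ℤ) :
    IsWeight g W ↔ W = weight g := by
  constructor
  · rintro ⟨hW, h⟩
    rw [show g = _ from funext h, weight_finsum hW]
  · rintro rfl
    have hW : InitiallyZero (weight g) := by
      obtain ⟨a, ha⟩ := hg
      refine ⟨a, fun p hp => ?_⟩
      simp only [weight]
      rw [ha p hp, ha (p.1 - 1, p.2) (by simp only; omega),
        ha (p.1, p.2 - 1) (by simp only; omega), ha (p.1 - 1, p.2 - 1) (by simp only; omega)]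
      ring
    refine ⟨hW, fun d => ?_⟩
    have hd : InitiallyZero (fun d => g d - ∑ᶠ d' ∈ Set.Iic d, weight g d') := by
      obtain ⟨a, ha⟩ := hg
      obtain ⟨b, hb⟩ := hW
      refine ⟨min a b, fun p hp => ?_⟩
      have : ∑ᶠ d' ∈ Set.Iic p, weight g d' = 0 := by
        refine finsum_mem_eq_zero_of_forall_eq_zero fun q hq => hb q ?_
        have := hq.1
        have := hq.2
        omega
      simp only [this, ha p (by omega), sub_zero]
    have := eq_zero_of_weight_eq_zero hd (fun p => by
      have e := congrFun (weight_finsum hW) p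
      simp only [weight] at e ⊢
      linarith) d
    linarith

/-- `W : ℤ² → ℤ` is bounded. -/
def IsBoundedWeight (W : ℤ × ℤ → ℤ) : Prop := ∃ C : ℤ, ∀ p, |W p| ≤ C

/-- A perfect matching: an initially and eventually zero `W : ℤ² → ℤ` that is the indicator
function of the graph of a permutation of `ℤ`. -/
def IsPerfectMatching (W : ℤ × ℤ → ℤ) : Prop :=
  InitiallyZero W ∧ EventuallyZero W ∧
    ∃ π : Equiv.Perm ℤ, ∀ i j : ℤ, W (i, j) = if j = π i then 1 else 0

/-- A way of writing `W = (W_1 + ⋯ + W_s) - (W̃_1 + ⋯ + W̃_{s-1})`, `s ≥ 1`, with perfect matchings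
`W_r`, `W̃_r`; here `s = m + 1`. -/
structure MatchingDecomposition (W : ℤ × ℤ → ℤ) where
  m : ℕ
  pos : Fin (m + 1) → ℤ × ℤ → ℤ
  neg : Fin m → ℤ × ℤ → ℤ
  pos_matching : ∀ r, IsPerfectMatching (pos r)
  neg_matching : ∀ r, IsPerfectMatching (neg r)
  sum_eq : ∀ p, W p = ∑ r, pos r p - ∑ r, neg r p

/-! ### `k`-diagrams -/

/-- The five positions of a `k`-diagram. -/
inductive Pos
  | B1 | B2 | B3 | A1 | A2

/-- The four arrows of a `k`-diagram. -/
inductive Arrow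
  | r11 | r22 | r31 | r32

/-- The source of an arrow. -/
@[reducible] def Arrow.src : Arrow → Pos
  | r11 => .B1
  | r22 => .B2
  | r31 => .B3
  | r32 => .B3

/-- The target of an arrow. -/
@[reducible] def Arrow.tgt : Arrow → Pos
  | r11 => .A1
  | r22 => .A2
  | r31 => .A1
  | r32 => .A2

/-- A `k`-diagram: five `k`-vector spaces and the four restriction maps
`B1 → A1`, `B2 → A2`, `B3 → A1`, `B3 → A2`. -/
structure KDiagram (k : Type u) [Field k] where
  val : Pos → Type u
  [acg : ∀ v, AddCommGroup (val v)]
  [mod : ∀ v, Module k (val v)]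
  res : ∀ e : Arrow, val e.src →ₗ[k] val e.tgt

attribute [instance] KDiagram.acg KDiagram.mod

namespace KDiagram

variable {k : Type u} [Field k]

/-- The differential
`∂ (b₁, b₂, b₃) = (ρ₁₁ b₁ - ρ₃₁ b₃, ρ₂₂ b₂ - ρ₃₂ b₃)`. -/
def diff (F : KDiagram k) :
    (F.val .B1 × F.val .B2 × F.val .B3) →ₗ[k] (F.val .A1 × F.val .A2) :=
  let b1 : (F.val .B1 × F.val .B2 × F.val .B3) →ₗ[k] F.val .B1 := LinearMap.fst k _ _
  let b2 : (F.val .B1 × F.val .B2 × F.val .B3) →ₗ[k] F.val .B2 :=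
    LinearMap.fst k _ _ ∘ₗ LinearMap.snd k _ _
  let b3 : (F.val .B1 × F.val .B2 × F.val .B3) →ₗ[k] F.val .B3 :=
    LinearMap.snd k _ _ ∘ₗ LinearMap.snd k _ _
  let ρ11 : F.val .B1 →ₗ[k] F.val .A1 := F.res .r11
  let ρ22 : F.val .B2 →ₗ[k] F.val .A2 := F.res .r22
  let ρ31 : F.val .B3 →ₗ[k] F.val .A1 := F.res .r31
  let ρ32 : F.val .B3 →ₗ[k] F.val .A2 := F.res .r32
  LinearMap.prod (ρ11 ∘ₗ b1 - ρ31 ∘ₗ b3) (ρ22 ∘ₗ b2 - ρ32 ∘ₗ b3)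

/-- A `k`-diagram is Fredholm if both cohomology groups `H⁰ = ker ∂` and `H¹ = coker ∂` are
finite dimensional. -/
def IsFredholm (F : KDiagram k) : Prop :=
  FiniteDimensional k (LinearMap.ker F.diff) ∧
    FiniteDimensional k ((F.val .A1 × F.val .A2) ⧸ LinearMap.range F.diff)

/-- An isomorphism of `k`-diagrams: linear isomorphisms of all values that commute with the
restriction maps. -/
structure Iso (F G : KDiagram k) where
  app : ∀ v, F.val v ≃ₗ[k] G.val v
  comm : ∀ (e : Arrow) (x : F.val e.src), G.res e (app e.src x) = app e.tgt (F.res e x)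

/-- The direct sum of two `k`-diagrams. -/
def sum (F G : KDiagram k) : KDiagram k where
  val v := F.val v × G.val v
  res e := LinearMap.prodMap (F.res e) (G.res e)

/-- The direct sum of a family of `k`-diagrams. -/
def directSum {L : Type} (F : L → KDiagram k) : KDiagram k where
  val v := DirectSum L fun l => (F l).val v
  res e := DirectSum.lmap fun l => (F l).res e

end KDiagram

/-- The multiset on `ℤ × ℤ` with (non-negative) multiplicities `W`, as a set of triples. -/
def Multi (W : ℤ × ℤ → ℤ) : Type :=
  {q : ℤ × ℤ × ℕ // 1 ≤ q.2.2 ∧ (q.2.2 : ℤ) ≤ W (q.1, q.2.1)}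

/-- The index sets of the standard bases of the values of `M_{W,d}`. -/
def modelIndex (W : ℤ × ℤ → ℤ) (d : ℤ × ℤ) : Pos → Type
  | .B1 => {a : ℤ // a ≤ d.1}
  | .B2 => {a : ℤ // a ≤ d.2}
  | .B3 => Multi W
  | .A1 => ℤ
  | .A2 => ℤ

/-- The maps of bases that induce the restriction maps of `M_{W,d}`: the two inclusions, and the
first and second projections of `Multi W`. -/
def modelMap (W : ℤ × ℤ → ℤ) (d : ℤ × ℤ) : ∀ e : Arrow, modelIndex W d e.src → modelIndex W d e.tgt
  | .r11 => fun a : {a : ℤ // a ≤ d.1} => a.1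
  | .r22 => fun a : {a : ℤ // a ≤ d.2} => a.1
  | .r31 => fun q : Multi W => q.1.1
  | .r32 => fun q : Multi W => q.1.2.1

/-- The `k`-diagram `M_{W,d}` of a non-negative `W : ℤ² → ℤ` and `d ∈ ℤ²`. -/
noncomputable def modelDiagram (k : Type u) [Field k] (W : ℤ × ℤ → ℤ) (d : ℤ × ℤ) :
    KDiagram k where
  val v := modelIndex W d v →₀ k
  res e := Finsupp.lmapDomain k k (modelMap W d e)

/-! ### Virtual `k`-diagrams -/

/-- A formal difference `plus ⊖ minus` of `k`-diagrams. -/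
structure VirtualDiagram (k : Type u) [Field k] where
  plus : KDiagram k
  minus : KDiagram k

namespace VirtualDiagram

variable {k : Type u} [Field k]

/-- Both parts are Fredholm. -/
def IsFredholm (V : VirtualDiagram k) : Prop := V.plus.IsFredholm ∧ V.minus.IsFredholm

/-- Equivalence of virtual Fredholm `k`-diagrams: `F₁ ⊖ F₂ ∼ F₁' ⊖ F₂'` if
`F₁ ⊕ F₂' ⊕ F₀ ≃ F₁' ⊕ F₂ ⊕ F₀` for some Fredholm `F₀`; everything that occurs has to be
Fredholm. -/
def Equivalent (V V' : VirtualDiagram k) : Prop :=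
  V.IsFredholm ∧ V'.IsFredholm ∧ ∃ F₀ : KDiagram k, F₀.IsFredholm ∧
    Nonempty (KDiagram.Iso ((V.plus.sum V'.minus).sum F₀) ((V'.plus.sum V.minus).sum F₀))

end VirtualDiagram

/-- The virtual `k`-diagram `(M_{W_1,d} ⊕ ⋯ ⊕ M_{W_s,d}) ⊖ (M_{W̃_1,d} ⊕ ⋯ ⊕ M_{W̃_{s-1},d})` of a
decomposition of `W`. -/
noncomputable def MatchingDecomposition.virtual (k : Type u) [Field k] {W : ℤ × ℤ → ℤ}
    (D : MatchingDecomposition W) (d : ℤ × ℤ) : VirtualDiagram k where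
  plus := KDiagram.directSum fun r => modelDiagram k (D.pos r) d
  minus := KDiagram.directSum fun r => modelDiagram k (D.neg r) d

/-- The class `[M_{W,d}]`: all virtual Fredholm `k`-diagrams that are equivalent to the virtual
diagram of some decomposition of `W`. (That this is a single equivalence class is part of the
theorem; it is empty if `W` has no decomposition.) -/
def virtualClass (k : Type u) [Field k] (W : ℤ × ℤ → ℤ) (d : ℤ × ℤ) : Set (VirtualDiagram k) :=
  {V | ∃ D : MatchingDecomposition W, V.Equivalent (D.virtual k d)}

/-- `W_{f;i,j,d}`, the weight of the two-variable restriction `f_{i,j,d}`. -/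
def restrictionWeight {n : ℕ} (f : (Fin n → ℤ) → ℤ) (i j : Fin n) (d : Fin n → ℤ) :
    ℤ × ℤ → ℤ :=
  weight (twoVar f i j d)

/-- The class `[M_{f;i,j,d}] = [M_{W,0}]` with `W = W_{f;i,j,d}`. -/
def restrictionClass (k : Type u) [Field k] {n : ℕ} (f : (Fin n → ℤ) → ℤ) (i j : Fin n)
    (d : Fin n → ℤ) : Set (VirtualDiagram k) :=
  virtualClass k (restrictionWeight f i j d) (0, 0)

/-!
For a perfect matching `W`, the diagram `M_{W,d}` is the direct sum, over the points `(a₁, a₂)` with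
`W (a₁, a₂) = 1`, of small diagrams of four types, according to whether `a₁ ≤ d₁` and whether
`a₂ ≤ d₂`. Finitely many points satisfy both inequalities, and these make up `H⁰`; finitely many
satisfy neither, and these make up `H¹`; each of the two mixed types occurs countably infinitely
often. So a direct sum of such diagrams is determined up to isomorphism by the numbers of points in
the quadrants `≤ d` and `> d`, and the virtual diagram of a decomposition of `W` depends only on the
sums of `W` over the two quadrants. For `W = W_{f;i,j,d}` and `d = 0` these are `f d` and, by Serre
duality, `f d - deg d - C`, whatever `i` and `j` are.

All rows and columns of `W_{f;i,j,d}` have sum `1`. If `W` is bounded, adding a large constant on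
the strip that contains its support makes it the non-negative adjacency matrix of a regular,
locally finite bipartite multigraph. Hall's marriage theorem matches each side into the other, the
Schröder–Bernstein theorem combines the two injections into a perfect matching, and removing it
lowers the degree by one.
-/

/-! ### Linear maps with finite kernel and cokernel -/

section FiniteKerCoker

variable {R M N M' N' : Type*} [Ring R] [AddCommGroup M] [Module R M] [AddCommGroup N]
  [Module R N] [AddCommGroup M'] [Module R M'] [AddCommGroup N'] [Module R N']

theorem coFG_ker_of_surjective [Module.Finite R N] {T : M →ₗ[R] N}
    (hT : Function.Surjective T) : (LinearMap.ker T).CoFG :=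
  Module.Finite.equiv (T.quotKerEquivOfSurjective hT).symm

/-- A linear map whose kernel and cokernel are finitely generated. `KDiagram.IsFredholm` is this
property of the differential `KDiagram.diff`. -/
def HasFiniteKerCoker (T : M →ₗ[R] N) : Prop :=
  Module.Finite R (LinearMap.ker T) ∧ Module.Finite R (N ⧸ LinearMap.range T)

namespace HasFiniteKerCoker

theorem of_conj {T : M →ₗ[R] N} {T' : M' →ₗ[R] N'} (hT : HasFiniteKerCoker T)
    (e : M ≃ₗ[R] M') (g : N ≃ₗ[R] N') (h : ∀ x, T' (e x) = g (T x)) : HasFiniteKerCoker T' := by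
  have := hT.1
  have := hT.2
  have hcomm : T' ∘ₗ (e : M →ₗ[R] M') = (g : N →ₗ[R] N') ∘ₗ T := LinearMap.ext h
  have hker : LinearMap.ker T = (LinearMap.ker T').comap (e : M →ₗ[R] M') := by
    rw [← LinearMap.ker_comp, hcomm, LinearEquiv.ker_comp]
  have hrange : (LinearMap.range T).map (g : N →ₗ[R] N') = LinearMap.range T' := by
    rw [← LinearMap.range_comp, ← hcomm, LinearEquiv.range_comp]
  exact ⟨Module.Finite.equiv ((LinearEquiv.ofEq _ _ hker).trans (e.ofSubmodule' _)),
    Module.Finite.equiv (Submodule.Quotient.equiv _ _ g hrange)⟩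

theorem prodMap {T : M →ₗ[R] N} {T' : M' →ₗ[R] N'} (hT : HasFiniteKerCoker T)
    (hT' : HasFiniteKerCoker T') : HasFiniteKerCoker (T.prodMap T') := by
  have := hT.2
  have := hT'.2
  constructor
  · rw [LinearMap.ker_prodMap, Module.Finite.iff_fg]
    exact (Module.Finite.iff_fg.1 hT.1).prod (Module.Finite.iff_fg.1 hT'.1)
  · have hker : LinearMap.ker ((LinearMap.range T).mkQ.prodMap (LinearMap.range T').mkQ) =
        LinearMap.range (T.prodMap T') := by
      rw [LinearMap.ker_prodMap, Submodule.ker_mkQ, Submodule.ker_mkQ, LinearMap.range_prodMap]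
    exact hker ▸ coFG_ker_of_surjective
      ((Submodule.mkQ_surjective _).prodMap (Submodule.mkQ_surjective _))

end HasFiniteKerCoker

section PairDifferential

variable {i₁ : M →ₗ[R] N} {i₂ : M' →ₗ[R] N} {T : M × M' × N →ₗ[R] N × N}

theorem finite_ker_of_inf_fg (h₁ : Function.Injective i₁) (h₂ : Function.Injective i₂)
    (hinf : (LinearMap.range i₁ ⊓ LinearMap.range i₂).FG)
    (hT : ∀ x y z, T (x, y, z) = (i₁ x - z, i₂ y - z)) :
    Module.Finite R (LinearMap.ker T) := by
  have mem_ker : ∀ x y z, (x, y, z) ∈ LinearMap.ker T ↔ i₁ x = z ∧ i₂ y = z := by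
    simp [hT, sub_eq_zero]
  let π : LinearMap.ker T →ₗ[R] N :=
    LinearMap.snd R M' N ∘ₗ LinearMap.snd R M (M' × N) ∘ₗ (LinearMap.ker T).subtype
  have π_injective : Function.Injective π := by
    rintro ⟨⟨x, y, z⟩, h⟩ ⟨⟨x', y', z'⟩, h'⟩ (rfl : z = z')
    rw [mem_ker] at h h'
    obtain rfl := h₁ (h.1.trans h'.1.symm)
    obtain rfl := h₂ (h.2.trans h'.2.symm)
    rfl
  have range_π : LinearMap.range π = LinearMap.range i₁ ⊓ LinearMap.range i₂ := by
    ext z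
    constructor
    · rintro ⟨⟨⟨x, y, z⟩, h⟩, rfl⟩
      rw [mem_ker] at h
      exact ⟨⟨x, h.1⟩, ⟨y, h.2⟩⟩
    · rintro ⟨⟨x, hx⟩, ⟨y, hy⟩⟩
      exact ⟨⟨(x, y, z), (mem_ker x y z).2 ⟨hx, hy⟩⟩, rfl⟩
  have : Module.Finite R (LinearMap.range π) := Module.Finite.iff_fg.2 (range_π ▸ hinf)
  exact Module.Finite.equiv (LinearEquiv.ofInjective π π_injective).symm

theorem finite_coker_of_sup_coFG (hsup : (LinearMap.range i₁ ⊔ LinearMap.range i₂).CoFG)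
    (hT : ∀ x y z, T (x, y, z) = (i₁ x - z, i₂ y - z)) :
    Module.Finite R ((N × N) ⧸ LinearMap.range T) := by
  have : Module.Finite R (N ⧸ (LinearMap.range i₁ ⊔ LinearMap.range i₂)) := hsup
  let δ : N × N →ₗ[R] N := LinearMap.fst R N N - LinearMap.snd R N N
  have δ_surjective : Function.Surjective δ := fun z => ⟨(z, 0), sub_zero z⟩
  have range_T : LinearMap.ker ((LinearMap.range i₁ ⊔ LinearMap.range i₂).mkQ ∘ₗ δ) =
      LinearMap.range T := by
    rw [LinearMap.ker_comp, Submodule.ker_mkQ]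
    ext ⟨a, b⟩
    constructor
    · intro h
      obtain ⟨_, ⟨x, rfl⟩, _, ⟨y, rfl⟩, hxy⟩ := Submodule.mem_sup.1 h
      have hxy : i₁ x + i₂ y = a - b := hxy
      refine ⟨(x, -y, i₁ x - a), (hT _ _ _).trans (Prod.ext (sub_sub_cancel _ _) ?_)⟩
      calc i₂ (-y) - (i₁ x - a) = a - (i₁ x + i₂ y) := by rw [map_neg]; abel
        _ = b := by rw [hxy, sub_sub_cancel]
    · rintro ⟨⟨x, y, z⟩, h⟩
      rw [hT, Prod.mk.injEq] at h
      obtain ⟨rfl, rfl⟩ := h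
      refine Submodule.mem_sup.2 ⟨_, ⟨x, rfl⟩, _, ⟨-y, rfl⟩, ?_⟩
      change i₁ x + i₂ (-y) = i₁ x - z - (i₂ y - z)
      rw [map_neg]
      abel
  exact range_T ▸ coFG_ker_of_surjective ((Submodule.mkQ_surjective _).comp δ_surjective)

end PairDifferential

end FiniteKerCoker

/-! ### Isomorphism classes of diagrams -/

section DirectSum

open DirectSum

variable {R ι κ : Type*} [Semiring R] {M N : ι ⊕ κ → Type*} [∀ x, AddCommMonoid (M x)]
  [∀ x, Module R (M x)] [∀ x, AddCommMonoid (N x)] [∀ x, Module R (N x)]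

variable (R M) in
/-- A direct sum over a disjoint union of index types is the product of the two direct sums. -/
noncomputable def directSumSumEquivProd :
    (⨁ x, M x) ≃ₗ[R] (⨁ i, M (.inl i)) × (⨁ j, M (.inr j)) := by
  classical
  exact LinearEquiv.ofLinearMap
    (toModule R _ _ fun
      | .inl i => LinearMap.inl R _ _ ∘ₗ lof R ι (fun i => M (.inl i)) i
      | .inr j => LinearMap.inr R _ _ ∘ₗ lof R κ (fun j => M (.inr j)) j)
    ((toModule R ι _ fun i => lof R _ M (.inl i)).coprod
      (toModule R κ _ fun j => lof R _ M (.inr j)))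
    (by ext <;> simp) (by ext (i | j) <;> simp)

theorem directSumSumEquivProd_lmap (f : ∀ x, M x →ₗ[R] N x) (m : ⨁ x, M x) :
    directSumSumEquivProd R N (lmap f m) =
      (lmap fun i => f (.inl i)).prodMap (lmap fun j => f (.inr j))
        (directSumSumEquivProd R M m) := by
  classical
  suffices (directSumSumEquivProd R N).toLinearMap ∘ₗ lmap f =
      (lmap fun i => f (.inl i)).prodMap (lmap fun j => f (.inr j)) ∘ₗ
        (directSumSumEquivProd R M).toLinearMap from LinearMap.congr_fun this m
  ext (i | j) <;> simp [directSumSumEquivProd]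

end DirectSum

namespace KDiagram

variable {k : Type u} [Field k]

namespace Iso

/-- The identity isomorphism. -/
def refl (F : KDiagram k) : Iso F F where
  app _ := LinearEquiv.refl k _
  comm _ _ := rfl

/-- The inverse isomorphism. -/
def symm {F G : KDiagram k} (φ : Iso F G) : Iso G F where
  app v := (φ.app v).symm
  comm e x := by
    rw [LinearEquiv.eq_symm_apply, ← φ.comm, LinearEquiv.apply_symm_apply]

/-- The composition of two isomorphisms. -/
def trans {F G H : KDiagram k} (φ : Iso F G) (ψ : Iso G H) : Iso F H where
  app v := (φ.app v).trans (ψ.app v)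
  comm e x := by rw [LinearEquiv.trans_apply, ψ.comm, φ.comm, LinearEquiv.trans_apply]

/-- The direct sum of two isomorphisms. -/
def sumCongr {F G F' G' : KDiagram k} (φ : Iso F F') (ψ : Iso G G') :
    Iso (F.sum G) (F'.sum G') where
  app v := (φ.app v).prodCongr (ψ.app v)
  comm e x := Prod.ext (φ.comm e x.1) (ψ.comm e x.2)

/-- Direct sums of `k`-diagrams are commutative up to isomorphism. -/
def sumComm (F G : KDiagram k) : Iso (F.sum G) (G.sum F) where
  app _ := LinearEquiv.prodComm k _ _
  comm _ _ := rfl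

/-- Direct sums of `k`-diagrams are associative up to isomorphism. -/
def sumAssoc (F G H : KDiagram k) : Iso ((F.sum G).sum H) (F.sum (G.sum H)) where
  app _ := LinearEquiv.prodAssoc k _ _ _
  comm _ _ := rfl

/-- A direct sum of `k`-diagrams over a disjoint union of index types is the sum of the two direct
sums. -/
noncomputable def directSumSum {L K : Type} (F : L ⊕ K → KDiagram k) :
    Iso (directSum F) ((directSum fun l => F (.inl l)).sum (directSum fun l => F (.inr l))) where
  app v := directSumSumEquivProd k fun l => (F l).val v
  comm e x := (directSumSumEquivProd_lmap (fun l => (F l).res e) x).symm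

theorem isFredholm {F G : KDiagram k} (φ : Iso F G) (hF : F.IsFredholm) : G.IsFredholm := by
  refine HasFiniteKerCoker.of_conj (T := F.diff) hF
    ((φ.app .B1).prodCongr ((φ.app .B2).prodCongr (φ.app .B3)))
    ((φ.app .A1).prodCongr (φ.app .A2)) fun b => Prod.ext ?_ ?_
  · exact (congrArg₂ (· - ·) (φ.comm .r11 b.1) (φ.comm .r31 b.2.2)).trans (map_sub _ _ _).symm
  · exact (congrArg₂ (· - ·) (φ.comm .r22 b.2.1) (φ.comm .r32 b.2.2)).trans (map_sub _ _ _).symm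

end Iso

theorem IsFredholm.sum {F G : KDiagram k} (hF : F.IsFredholm) (hG : G.IsFredholm) :
    (F.sum G).IsFredholm :=
  (HasFiniteKerCoker.prodMap (T := F.diff) (T' := G.diff) hF hG).of_conj (T' := (F.sum G).diff)
    ((LinearEquiv.prodProdProdComm k _ _ _ _).trans
      ((LinearEquiv.refl k _).prodCongr (LinearEquiv.prodProdProdComm k _ _ _ _)))
    (LinearEquiv.prodProdProdComm k _ _ _ _) fun _ => rfl

/-- Isomorphism of `k`-diagrams. -/
instance isoSetoid (k : Type u) [Field k] : Setoid (KDiagram k) where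
  r F G := Nonempty (Iso F G)
  iseqv :=
    { refl := fun F => ⟨Iso.refl F⟩
      symm := fun ⟨φ⟩ => ⟨φ.symm⟩
      trans := fun ⟨φ⟩ ⟨ψ⟩ => ⟨φ.trans ψ⟩ }

/-- The isomorphism classes of `k`-diagrams, a commutative semigroup under direct sums: in it the
isomorphisms behind an equivalence of virtual diagrams become equations. -/
def IsoClass (k : Type u) [Field k] : Type (u + 1) := Quotient (isoSetoid k)

/-- The isomorphism class of a `k`-diagram. -/
def isoClass (F : KDiagram k) : IsoClass k := Quotient.mk _ F

theorem isoClass_eq_isoClass {F G : KDiagram k} :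
    F.isoClass = G.isoClass ↔ Nonempty (Iso F G) :=
  Quotient.eq

instance : AddCommSemigroup (IsoClass k) where
  add := Quotient.map₂ sum fun _ _ ⟨φ⟩ _ _ ⟨ψ⟩ => ⟨φ.sumCongr ψ⟩
  add_assoc := by
    rintro ⟨F⟩ ⟨G⟩ ⟨H⟩
    exact Quotient.sound ⟨Iso.sumAssoc F G H⟩
  add_comm := by
    rintro ⟨F⟩ ⟨G⟩
    exact Quotient.sound ⟨Iso.sumComm F G⟩

theorem isoClass_sum (F G : KDiagram k) : (F.sum G).isoClass = F.isoClass + G.isoClass :=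
  rfl

end KDiagram

namespace VirtualDiagram

open KDiagram

variable {k : Type u} [Field k] {V V' V'' : VirtualDiagram k}

theorem equivalent_iff :
    V.Equivalent V' ↔ V.IsFredholm ∧ V'.IsFredholm ∧ ∃ F₀ : KDiagram k, F₀.IsFredholm ∧
      V.plus.isoClass + V'.minus.isoClass + F₀.isoClass =
        V'.plus.isoClass + V.minus.isoClass + F₀.isoClass := by
  simp only [Equivalent, ← isoClass_eq_isoClass, isoClass_sum]

theorem Equivalent.symm (h : V.Equivalent V') : V'.Equivalent V := by
  obtain ⟨hV, hV', F, hF, ⟨φ⟩⟩ := h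
  exact ⟨hV', hV, F, hF, ⟨φ.symm⟩⟩

theorem Equivalent.trans (h : V.Equivalent V') (h' : V'.Equivalent V'') : V.Equivalent V'' := by
  rw [equivalent_iff] at *
  obtain ⟨hV, hV', F, hF, e⟩ := h
  obtain ⟨-, hV'', G, hG, e'⟩ := h'
  refine ⟨hV, hV'', (V'.plus.sum V'.minus).sum (F.sum G), (hV'.1.sum hV'.2).sum (hF.sum hG), ?_⟩
  simp only [isoClass_sum]
  calc V.plus.isoClass + V''.minus.isoClass +
        (V'.plus.isoClass + V'.minus.isoClass + (F.isoClass + G.isoClass))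
      = (V.plus.isoClass + V'.minus.isoClass + F.isoClass) +
        (V'.plus.isoClass + V''.minus.isoClass + G.isoClass) := by ac_rfl
    _ = (V'.plus.isoClass + V.minus.isoClass + F.isoClass) +
        (V''.plus.isoClass + V'.minus.isoClass + G.isoClass) := by rw [e, e']
    _ = V''.plus.isoClass + V.minus.isoClass +
        (V'.plus.isoClass + V'.minus.isoClass + (F.isoClass + G.isoClass)) := by ac_rfl

end VirtualDiagram

/-! ### Free diagrams and edge diagrams -/

section Finsupp

variable {R : Type*} [Semiring R]

theorem sigmaFinsuppLequivDFinsupp_lmapDomain {L : Type*} {α β : L → Type*}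
    (f : ∀ l, α l → β l) (x : (Σ l, α l) →₀ R) :
    sigmaFinsuppLequivDFinsupp R (Finsupp.lmapDomain R R (Sigma.map id f) x) =
      DirectSum.lmap (fun l => Finsupp.lmapDomain R R (f l))
        (sigmaFinsuppLequivDFinsupp R x) := by
  classical
  suffices (sigmaFinsuppLequivDFinsupp R).toLinearMap ∘ₗ
      Finsupp.lmapDomain R R (Sigma.map id f) =
      DirectSum.lmap (fun l => Finsupp.lmapDomain R R (f l)) ∘ₗ
        (sigmaFinsuppLequivDFinsupp R).toLinearMap from LinearMap.congr_fun this x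
  refine Finsupp.lhom_ext fun ⟨l, a⟩ r => ?_
  have lmap_single : DirectSum.lmap (fun l => Finsupp.lmapDomain R R (f l))
      (DFinsupp.single l (Finsupp.single a r)) = DFinsupp.single l (Finsupp.single (f l a) r) :=
    (DirectSum.lmap_lof (R := R) _ l _).trans
      (congrArg (DFinsupp.single l) Finsupp.mapDomain_single)
  simpa [Sigma.map] using lmap_single.symm

theorem range_lmapDomain_coe {α : Type*} (s : Set α) :
    LinearMap.range (Finsupp.lmapDomain R R ((↑) : s → α)) = Finsupp.supported R R s := by
  rw [LinearMap.range_eq_map, ← Finsupp.supported_univ, Finsupp.lmapDomain_supported,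
    Set.image_univ, Subtype.range_coe]

theorem supported_fg {α : Type*} {s : Set α} (hs : s.Finite) : (Finsupp.supported R R s).FG := by
  rw [Finsupp.supported_eq_span_single]
  exact Submodule.fg_span (hs.image _)

theorem supported_coFG {R α : Type*} [Ring R] {s : Set α} (hs : sᶜ.Finite) :
    (Finsupp.supported R R s).CoFG :=
  Submodule.FG.cofg_of_codisjoint (Finsupp.codisjoint_supported_supported
    isCompl_compl.symm.codisjoint) (supported_fg hs)

end Finsupp

namespace KDiagram

/-- The diagram of free modules on a diagram of sets; it makes sense of `modelDiagram` for
arbitrary diagrams of bases. -/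
noncomputable def free (k : Type u) [Field k] (S : Pos → Type)
    (m : ∀ e : Arrow, S e.src → S e.tgt) : KDiagram k where
  val v := S v →₀ k
  res e := Finsupp.lmapDomain k k (m e)

/-- The bases of `edgeDiagram`. -/
def edgeIndex {E : Type} (s t : Set E) : Pos → Type
  | .B1 => s
  | .B2 => t
  | .B3 => E
  | .A1 => E
  | .A2 => E

/-- The maps of bases of `edgeDiagram`. -/
def edgeMap {E : Type} (s t : Set E) : ∀ a : Arrow, edgeIndex s t a.src → edgeIndex s t a.tgt
  | .r11 => fun e : s => e.1
  | .r22 => fun e : t => e.1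
  | .r31 => fun e : E => e
  | .r32 => fun e : E => e

/-- The direct sum, over the edges `e : E`, of the diagrams with `B₃ = A₁ = A₂ = k` in which `B₁`
is `k` or `0` according to whether `e ∈ s`, and `B₂` is `k` or `0` according to whether `e ∈ t`. -/
noncomputable def edgeDiagram (k : Type u) [Field k] {E : Type} (s t : Set E) : KDiagram k :=
  free k (edgeIndex s t) (edgeMap s t)

variable {k : Type u} [Field k]

namespace Iso

/-- The isomorphism of free diagrams induced by an isomorphism of their bases. -/
noncomputable def freeCongr {S S' : Pos → Type} {m : ∀ e : Arrow, S e.src → S e.tgt}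
    {m' : ∀ e : Arrow, S' e.src → S' e.tgt} (φ : ∀ v, S v ≃ S' v)
    (h : ∀ e x, m' e (φ _ x) = φ _ (m e x)) : Iso (free k S m) (free k S' m') where
  app v := Finsupp.domLCongr (φ v)
  comm e := LinearMap.congr_fun (f := Finsupp.lmapDomain k k (m' e) ∘ₗ
      (Finsupp.domLCongr (φ e.src)).toLinearMap)
    (g := (Finsupp.domLCongr (φ e.tgt)).toLinearMap ∘ₗ Finsupp.lmapDomain k k (m e)) <|
      Finsupp.lhom_ext fun x r => by simp [h]

/-- A direct sum of free diagrams is free on the disjoint union of the bases. -/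
noncomputable def freeDirectSum {L : Type} {S : L → Pos → Type}
    (m : ∀ l, ∀ e : Arrow, S l e.src → S l e.tgt) :
    Iso (free k (fun v => Σ l, S l v) fun e => Sigma.map id fun l => m l e)
      (directSum fun l => free k (S l) (m l)) where
  app _ := sigmaFinsuppLequivDFinsupp k
  comm e x := (sigmaFinsuppLequivDFinsupp_lmapDomain (fun l => m l e) x).symm

/-- The isomorphism of edge diagrams induced by a type-preserving bijection of edges. -/
noncomputable def edgeCongr {E E' : Type} {s t : Set E} {s' t' : Set E'} (φ : E ≃ E')
    (hs : ∀ e, e ∈ s ↔ φ e ∈ s') (ht : ∀ e, e ∈ t ↔ φ e ∈ t') :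
    Iso (edgeDiagram k s t) (edgeDiagram k s' t') :=
  freeCongr
    (fun
      | .B1 => φ.subtypeEquiv hs
      | .B2 => φ.subtypeEquiv ht
      | .B3 => φ
      | .A1 => φ
      | .A2 => φ)
    (by rintro (_ | _ | _ | _) _ <;> rfl)

end Iso

theorem nonempty_iso_edgeDiagram {E E' : Type} {s t : Set E} {s' t' : Set E'}
    (h₁ : Nonempty (↥(s ∩ t) ≃ ↥(s' ∩ t'))) (h₂ : Nonempty (↥(s \ t) ≃ ↥(s' \ t')))
    (h₃ : Nonempty (↥(t \ s) ≃ ↥(t' \ s'))) (h₄ : Nonempty (↥((s ∪ t)ᶜ) ≃ ↥((s' ∪ t')ᶜ))) :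
    Nonempty (Iso (edgeDiagram k s t) (edgeDiagram k s' t')) := by
  let type {E : Type} (s t : Set E) (e : E) : Prop × Prop := (e ∈ s, e ∈ t)
  have fiber : ∀ y, Nonempty ({e // type s t e = y} ≃ {e // type s' t' e = y}) := by
    have of_eq {y} {a : Set E} {b : Set E'} (h : Nonempty (a ≃ b))
        (ha : ∀ e, type s t e = y ↔ e ∈ a) (hb : ∀ e, type s' t' e = y ↔ e ∈ b) :
        Nonempty ({e // type s t e = y} ≃ {e // type s' t' e = y}) :=
      h.map fun φ => (Equiv.subtypeEquivRight ha).trans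
        (φ.trans (Equiv.subtypeEquivRight hb).symm)
    rintro ⟨p, q⟩
    by_cases hp : p <;> by_cases hq : q
    · exact of_eq h₁ (by simp [type, hp, hq]) (by simp [type, hp, hq])
    · exact of_eq h₂ (by simp [type, hp, hq]) (by simp [type, hp, hq])
    · exact of_eq h₃ (by simp [type, hp, hq, and_comm]) (by simp [type, hp, hq, and_comm])
    · exact of_eq h₄ (by simp [type, hp, hq]) (by simp [type, hp, hq])
  let φ : E ≃ E' := (Equiv.sigmaFiberEquiv (type s t)).symm.trans
    ((Equiv.sigmaCongrRight fun y => (fiber y).some).trans (Equiv.sigmaFiberEquiv (type s' t')))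
  have hφ : ∀ e, type s' t' (φ e) = type s t e := fun e => ((fiber (type s t e)).some ⟨e, rfl⟩).2
  exact ⟨Iso.edgeCongr φ (fun e => (congrArg Prod.fst (hφ e)).symm.to_iff)
    fun e => (congrArg Prod.snd (hφ e)).symm.to_iff⟩

theorem isFredholm_edgeDiagram {E : Type} {s t : Set E} (h : (s ∩ t).Finite)
    (h' : (s ∪ t)ᶜ.Finite) : (edgeDiagram k s t).IsFredholm := by
  let i (r : Set E) : (r →₀ k) →ₗ[k] (E →₀ k) := Finsupp.lmapDomain k k (↑)
  have i_injective (r : Set E) : Function.Injective (i r) :=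
    Finsupp.mapDomain_injective Subtype.val_injective
  have range_i (r : Set E) : LinearMap.range (i r) = Finsupp.supported k k r :=
    range_lmapDomain_coe r
  let T : (s →₀ k) × (t →₀ k) × (E →₀ k) →ₗ[k] (E →₀ k) × (E →₀ k) := (edgeDiagram k s t).diff
  have T_apply : ∀ b₁ b₂ b₃, T (b₁, b₂, b₃) = (i s b₁ - b₃, i t b₂ - b₃) := fun b₁ b₂ b₃ =>
    Prod.ext (congrArg (i s b₁ - ·) Finsupp.mapDomain_id)
      (congrArg (i t b₂ - ·) Finsupp.mapDomain_id)
  refine (⟨finite_ker_of_inf_fg (i_injective s) (i_injective t) ?_ T_apply,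
    finite_coker_of_sup_coFG ?_ T_apply⟩ : HasFiniteKerCoker T)
  · rw [range_i, range_i, ← Finsupp.supported_inter]
    exact supported_fg h
  · rw [range_i, range_i, ← Finsupp.supported_union]
    exact supported_coFG h'

end KDiagram

/-! ### Edges of perfect matchings -/

theorem finite_Ioi_prod_inter_support {W : ℤ × ℤ → ℤ} (hW : EventuallyZero W) (d : ℤ × ℤ) :
    (Set.Ioi d.1 ×ˢ Set.Ioi d.2 ∩ Function.support W).Finite := by
  obtain ⟨b, hb⟩ := hW
  refine (Set.finite_Icc d (b - d.2, b - d.1)).subset ?_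
  rintro p ⟨⟨h₁, h₂⟩, hp⟩
  have hpb : p.1 + p.2 < b := lt_of_not_ge fun h => hp (hb p h)
  rw [Set.mem_Ioi] at h₁ h₂
  exact ⟨⟨h₁.le, h₂.le⟩, by simp only; omega, by simp only; omega⟩

namespace IsPerfectMatching

variable {W : ℤ × ℤ → ℤ}

/-- The permutation of `ℤ` whose graph is the given perfect matching. -/
noncomputable def perm (hW : IsPerfectMatching W) : Equiv.Perm ℤ :=
  hW.2.2.choose

theorem apply_eq (hW : IsPerfectMatching W) (p : ℤ × ℤ) :
    W p = if p.2 = hW.perm p.1 then 1 else 0 :=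
  hW.2.2.choose_spec p.1 p.2

theorem apply_perm (hW : IsPerfectMatching W) (i : ℤ) : W (i, hW.perm i) = 1 := by
  simp [hW.apply_eq]

theorem exists_lt_add_perm (hW : IsPerfectMatching W) : ∃ a, ∀ i, a < i + hW.perm i := by
  obtain ⟨a, ha⟩ := hW.1
  refine ⟨a, fun i => lt_of_not_ge fun h => ?_⟩
  simpa [hW.apply_perm] using ha (i, hW.perm i) h

theorem exists_add_perm_lt (hW : IsPerfectMatching W) : ∃ b, ∀ i, i + hW.perm i < b := by
  obtain ⟨b, hb⟩ := hW.2.1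
  refine ⟨b, fun i => lt_of_not_ge fun h => ?_⟩
  simpa [hW.apply_perm] using hb (i, hW.perm i) h

theorem snd_eq_perm (hW : IsPerfectMatching W) (q : Multi W) :
    q.1.2.1 = hW.perm q.1.1 := by
  obtain ⟨⟨i, j, r⟩, h₁, h₂⟩ := q
  rw [hW.apply_eq] at h₂
  by_contra h
  rw [if_neg h] at h₂
  simp only at h₁ h₂
  omega

theorem bijective_fst (hW : IsPerfectMatching W) : Function.Bijective fun q : Multi W => q.1.1 := by
  have mult_eq_one (q : Multi W) : q.1.2.2 = 1 := by
    have := q.2.1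
    have := q.2.2
    rw [hW.apply_eq, if_pos (hW.snd_eq_perm q)] at this
    omega
  refine ⟨fun q q' h => ?_, fun i => ⟨⟨(i, hW.perm i, 1), le_rfl, ?_⟩, rfl⟩⟩
  · refine Subtype.ext (Prod.ext h (Prod.ext ?_ ?_))
    · rw [hW.snd_eq_perm, hW.snd_eq_perm]
      exact congrArg hW.perm h
    · rw [mult_eq_one, mult_eq_one]
  · simp [hW.apply_perm]

theorem finite_perm_mem (hW : IsPerfectMatching W) {S : Set (ℤ × ℤ)}
    (hS : (S ∩ Function.support W).Finite) : {i | (i, hW.perm i) ∈ S}.Finite := by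
  have graph_injective : Function.Injective fun i => (i, hW.perm i) := fun i j h =>
    congrArg Prod.fst h
  exact (hS.preimage graph_injective.injOn).subset fun i hi => ⟨hi, by simp [hW.apply_perm]⟩

theorem infinite_perm_mem_Iic_prod_Ioi (hW : IsPerfectMatching W) (d : ℤ × ℤ) :
    {i | (i, hW.perm i) ∈ Set.Iic d.1 ×ˢ Set.Ioi d.2}.Infinite := by
  obtain ⟨a, ha⟩ := hW.exists_lt_add_perm
  refine (Set.Iic_infinite (min d.1 (a - d.2))).mono fun i hi => ?_
  have := ha i
  simp only [Set.mem_Iic, le_min_iff] at hi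
  exact ⟨hi.1, by simp only [Set.mem_Ioi]; omega⟩

theorem infinite_perm_mem_Ioi_prod_Iic (hW : IsPerfectMatching W) (d : ℤ × ℤ) :
    {i | (i, hW.perm i) ∈ Set.Ioi d.1 ×ˢ Set.Iic d.2}.Infinite := by
  obtain ⟨b, hb⟩ := hW.exists_add_perm_lt
  refine (Set.Ioi_infinite (max d.1 (b - d.2))).mono fun i hi => ?_
  have := hb i
  simp only [Set.mem_Ioi, max_lt_iff] at hi
  exact ⟨hi.1, by simp only [Set.mem_Iic]; omega⟩

theorem finsum_mem_eq_ncard (hW : IsPerfectMatching W) {S : Set (ℤ × ℤ)}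
    (hS : (S ∩ Function.support W).Finite) :
    ∑ᶠ p ∈ S, W p = {i | (i, hW.perm i) ∈ S}.ncard := by
  have image_graph : (fun i => (i, hW.perm i)) '' {i | (i, hW.perm i) ∈ S} =
      S ∩ Function.support W := by
    ext ⟨i, j⟩
    simp only [Set.mem_image, Set.mem_ofPred_eq, Set.mem_inter_iff, Function.mem_support,
      hW.apply_eq, Prod.mk.injEq]
    aesop
  have graph_injective : Function.Injective fun i => (i, hW.perm i) := fun i j h =>
    congrArg Prod.fst h
  rw [← finsum_mem_inter_support, ← image_graph, finsum_mem_image graph_injective.injOn]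
  simp only [hW.apply_perm]
  rw [← finsum_one, Nat.cast_finsum_mem (hW.finite_perm_mem hS), Nat.cast_one]

end IsPerfectMatching

/-- A subset of a disjoint union is the disjoint union of its parts. -/
def subtypeSigmaEquiv {L : Type*} {α : L → Type*} (p : ∀ l, α l → Prop) :
    {e : Σ l, α l // p e.1 e.2} ≃ Σ l, {x // p l x} where
  toFun e := ⟨e.1.1, e.1.2, e.2⟩
  invFun x := ⟨⟨x.1, x.2⟩, x.2.2⟩

section Edges

variable {L : Type} {M : L → ℤ × ℤ → ℤ} (hM : ∀ l, IsPerfectMatching (M l)) (d : ℤ × ℤ)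

/-- The point of `ℤ²` on which an edge of a family of perfect matchings lies. The edges of a perfect
matching are numbered by their first coordinates. -/
noncomputable def edgePoint (e : Σ _ : L, ℤ) : ℤ × ℤ := (e.2, (hM e.1).perm e.2)

theorem finite_preimage_edgePoint [Finite L] {S : Set (ℤ × ℤ)}
    (hS : ∀ l, (S ∩ Function.support (M l)).Finite) : (edgePoint hM ⁻¹' S).Finite := by
  have := fun l => ((hM l).finite_perm_mem (hS l)).to_subtype
  exact Finite.of_equiv (Σ l, {i | (i, (hM l).perm i) ∈ S})
    (subtypeSigmaEquiv fun l i => (i, (hM l).perm i) ∈ S).symm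

theorem infinite_preimage_edgePoint {S : Set (ℤ × ℤ)} (l : L)
    (hS : {i | (i, (hM l).perm i) ∈ S}.Infinite) : (edgePoint hM ⁻¹' S).Infinite := by
  refine (hS.image (f := Sigma.mk (β := fun _ => ℤ) l) sigma_mk_injective.injOn).mono ?_
  rintro _ ⟨i, hi, rfl⟩
  exact hi

theorem ncard_preimage_edgePoint [Fintype L] {S : Set (ℤ × ℤ)}
    (hS : ∀ l, (S ∩ Function.support (M l)).Finite) :
    ((edgePoint hM ⁻¹' S).ncard : ℤ) = ∑ l, ∑ᶠ p ∈ S, M l p := by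
  have := fun l => ((hM l).finite_perm_mem (hS l)).to_subtype
  calc ((edgePoint hM ⁻¹' S).ncard : ℤ)
      = Nat.card (Σ l, {i | (i, (hM l).perm i) ∈ S}) :=
        congrArg _ (Nat.card_congr (subtypeSigmaEquiv fun l i => (i, (hM l).perm i) ∈ S))
    _ = ∑ l, ∑ᶠ p ∈ S, M l p := by
        simp only [Nat.card_sigma, Nat.cast_sum, (hM _).finsum_mem_eq_ncard (hS _),
          Nat.card_coe_set_eq]

open KDiagram

/-- The bijection between the basis of the edge diagram of a family of perfect matchings and the
basis of the direct sum of their diagrams. -/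
noncomputable def edgeIndexEquiv : ∀ v : Pos,
    edgeIndex (edgePoint hM ⁻¹' {p | p.1 ≤ d.1}) (edgePoint hM ⁻¹' {p | p.2 ≤ d.2}) v ≃
      Σ l, modelIndex (M l) d v
  | .B1 => subtypeSigmaEquiv fun _ i => i ≤ d.1
  | .B2 => (subtypeSigmaEquiv fun l i => (hM l).perm i ≤ d.2).trans <|
      Equiv.sigmaCongrRight fun l => (hM l).perm.subtypeEquiv fun _ => Iff.rfl
  | .B3 => Equiv.sigmaCongrRight fun l => (Equiv.ofBijective _ (hM l).bijective_fst).symm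
  | .A1 => Equiv.refl _
  | .A2 => Equiv.sigmaCongrRight fun l => (hM l).perm

/-- The direct sum of the diagrams of a family of perfect matchings is the diagram of its edges. -/
noncomputable def edgeDiagramIso (k : Type u) [Field k] :
    Iso (edgeDiagram k (edgePoint hM ⁻¹' {p | p.1 ≤ d.1}) (edgePoint hM ⁻¹' {p | p.2 ≤ d.2}))
      (directSum fun l => modelDiagram k (M l) d) :=
  (Iso.freeCongr (edgeIndexEquiv hM d) fun
    | .r11, _ => rfl
    | .r22, _ => rfl
    | .r31, ⟨l, i⟩ =>
      congrArg (Sigma.mk l) (Equiv.ofBijective_apply_symm_apply _ (hM l).bijective_fst i)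
    | .r32, ⟨l, i⟩ => congrArg (Sigma.mk l) (((hM l).snd_eq_perm _).trans
        (congrArg (hM l).perm
          (Equiv.ofBijective_apply_symm_apply _ (hM l).bijective_fst i)))).trans
    (Iso.freeDirectSum fun l => modelMap (M l) d)

end Edges

section Comparison

open KDiagram

variable {k : Type u} [Field k] {L L' : Type} {M : L → ℤ × ℤ → ℤ} {M' : L' → ℤ × ℤ → ℤ}
  {d : ℤ × ℤ}

theorem compl_union_fst_le_snd_le (d : ℤ × ℤ) :
    ({p | p.1 ≤ d.1} ∪ {p | p.2 ≤ d.2} : Set (ℤ × ℤ))ᶜ = Set.Ioi d.1 ×ˢ Set.Ioi d.2 := by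
  ext; simp

theorem nonempty_iso_edgeDiagram_preimage {E E' : Type} {f : E → ℤ × ℤ} {f' : E' → ℤ × ℤ}
    (h₁ : Nonempty (f ⁻¹' Set.Iic d ≃ f' ⁻¹' Set.Iic d))
    (h₂ : Nonempty (f ⁻¹' (Set.Iic d.1 ×ˢ Set.Ioi d.2) ≃ f' ⁻¹' (Set.Iic d.1 ×ˢ Set.Ioi d.2)))
    (h₃ : Nonempty (f ⁻¹' (Set.Ioi d.1 ×ˢ Set.Iic d.2) ≃ f' ⁻¹' (Set.Ioi d.1 ×ˢ Set.Iic d.2)))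
    (h₄ : Nonempty (f ⁻¹' (Set.Ioi d.1 ×ˢ Set.Ioi d.2) ≃ f' ⁻¹' (Set.Ioi d.1 ×ˢ Set.Ioi d.2))) :
    Nonempty (Iso (edgeDiagram k (f ⁻¹' {p | p.1 ≤ d.1}) (f ⁻¹' {p | p.2 ≤ d.2}))
      (edgeDiagram k (f' ⁻¹' {p | p.1 ≤ d.1}) (f' ⁻¹' {p | p.2 ≤ d.2}))) := by
  have mixed₁ : ({p | p.1 ≤ d.1} \ {p | p.2 ≤ d.2} : Set (ℤ × ℤ)) =
      Set.Iic d.1 ×ˢ Set.Ioi d.2 := by ext; simp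
  have mixed₂ : ({p | p.2 ≤ d.2} \ {p | p.1 ≤ d.1} : Set (ℤ × ℤ)) =
      Set.Ioi d.1 ×ˢ Set.Iic d.2 := by ext; simp [and_comm]
  rw [← mixed₁] at h₂
  rw [← mixed₂] at h₃
  rw [← compl_union_fst_le_snd_le] at h₄
  exact nonempty_iso_edgeDiagram h₁ h₂ h₃ h₄

theorem isFredholm_directSum_modelDiagram [Finite L] (hM : ∀ l, IsPerfectMatching (M l)) :
    (directSum fun l => modelDiagram k (M l) d).IsFredholm := by
  refine (edgeDiagramIso hM d k).isFredholm (isFredholm_edgeDiagram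
    (finite_preimage_edgePoint hM fun l => finite_Iic_inter_support (hM l).1 d) ?_)
  rw [← Set.preimage_union, ← Set.preimage_compl, compl_union_fst_le_snd_le]
  exact finite_preimage_edgePoint hM fun l => finite_Ioi_prod_inter_support (hM l).2.1 d

theorem nonempty_equiv_preimage_edgePoint_of_finite [Fintype L] [Fintype L']
    (hM : ∀ l, IsPerfectMatching (M l)) (hM' : ∀ l, IsPerfectMatching (M' l)) {S : Set (ℤ × ℤ)}
    (hS : ∀ l, (S ∩ Function.support (M l)).Finite)
    (hS' : ∀ l, (S ∩ Function.support (M' l)).Finite)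
    (h : ∑ l, ∑ᶠ p ∈ S, M l p = ∑ l, ∑ᶠ p ∈ S, M' l p) :
    Nonempty (edgePoint hM ⁻¹' S ≃ edgePoint hM' ⁻¹' S) := by
  have := (finite_preimage_edgePoint hM hS).to_subtype
  have := (finite_preimage_edgePoint hM' hS').to_subtype
  rw [← ncard_preimage_edgePoint hM hS, ← ncard_preimage_edgePoint hM' hS', Nat.cast_inj] at h
  exact Finite.card_eq.1 h

theorem nonempty_equiv_preimage_edgePoint_of_infinite [Countable L] [Countable L'] [Nonempty L]
    [Nonempty L'] (hM : ∀ l, IsPerfectMatching (M l)) (hM' : ∀ l, IsPerfectMatching (M' l))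
    {S : Set (ℤ × ℤ)} (hS : ∀ l, {i | (i, (hM l).perm i) ∈ S}.Infinite)
    (hS' : ∀ l, {i | (i, (hM' l).perm i) ∈ S}.Infinite) :
    Nonempty (edgePoint hM ⁻¹' S ≃ edgePoint hM' ⁻¹' S) := by
  have := (infinite_preimage_edgePoint hM _ (hS (Classical.arbitrary L))).to_subtype
  have := (infinite_preimage_edgePoint hM' _ (hS' (Classical.arbitrary L'))).to_subtype
  exact nonempty_equiv_of_countable

theorem nonempty_iso_directSum_modelDiagram [Fintype L] [Fintype L'] [Nonempty L] [Nonempty L']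
    (hM : ∀ l, IsPerfectMatching (M l)) (hM' : ∀ l, IsPerfectMatching (M' l))
    (lower : ∑ l, ∑ᶠ p ∈ Set.Iic d, M l p = ∑ l, ∑ᶠ p ∈ Set.Iic d, M' l p)
    (upper : ∑ l, ∑ᶠ p ∈ Set.Ioi d.1 ×ˢ Set.Ioi d.2, M l p =
      ∑ l, ∑ᶠ p ∈ Set.Ioi d.1 ×ˢ Set.Ioi d.2, M' l p) :
    Nonempty (Iso (directSum fun l => modelDiagram k (M l) d)
      (directSum fun l => modelDiagram k (M' l) d)) := by
  obtain ⟨φ⟩ := nonempty_iso_edgeDiagram_preimage (k := k)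
    (nonempty_equiv_preimage_edgePoint_of_finite hM hM'
      (fun l => finite_Iic_inter_support (hM l).1 d)
      (fun l => finite_Iic_inter_support (hM' l).1 d) lower)
    (nonempty_equiv_preimage_edgePoint_of_infinite hM hM'
      (fun l => (hM l).infinite_perm_mem_Iic_prod_Ioi d)
      fun l => (hM' l).infinite_perm_mem_Iic_prod_Ioi d)
    (nonempty_equiv_preimage_edgePoint_of_infinite hM hM'
      (fun l => (hM l).infinite_perm_mem_Ioi_prod_Iic d)
      fun l => (hM' l).infinite_perm_mem_Ioi_prod_Iic d)
    (nonempty_equiv_preimage_edgePoint_of_finite hM hM'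
      (fun l => finite_Ioi_prod_inter_support (hM l).2.1 d)
      (fun l => finite_Ioi_prod_inter_support (hM' l).2.1 d) upper)
  exact ⟨(edgeDiagramIso hM d k).symm.trans (φ.trans (edgeDiagramIso hM' d k))⟩

end Comparison

section FinsumMem

variable {α M L K : Type*} [Fintype L] [Fintype K] {S : Set α}

theorem finsum_mem_sum_comm [AddCommMonoid M] {f : L → α → M}
    (hf : ∀ l, (S ∩ Function.support (f l)).Finite) :
    ∑ᶠ p ∈ S, ∑ l, f l p = ∑ l, ∑ᶠ p ∈ S, f l p := by
  have indicator_sum (p : α) :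
      S.indicator (fun p => ∑ l, f l p) p = ∑ l, S.indicator (f l) p := by
    by_cases hp : p ∈ S <;> simp [hp]
  simp only [finsum_mem_def, indicator_sum]
  refine (finsum_sum_comm Finset.univ (fun p l => S.indicator (f l) p) fun l _ => ?_)
  simpa only [Function.HasFiniteSupport, Set.support_indicator] using hf l

theorem finsum_mem_sum_sub_sum [AddCommGroup M] {f : L → α → M} {g : K → α → M}
    (hf : ∀ l, (S ∩ Function.support (f l)).Finite)
    (hg : ∀ r, (S ∩ Function.support (g r)).Finite) :
    ∑ᶠ p ∈ S, (∑ l, f l p - ∑ r, g r p) = ∑ l, ∑ᶠ p ∈ S, f l p - ∑ r, ∑ᶠ p ∈ S, g r p := by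
  calc ∑ᶠ p ∈ S, (∑ l, f l p - ∑ r, g r p)
      = ∑ᶠ p ∈ S, ∑ x : L ⊕ K, Sum.elim f (fun r p => -g r p) x p := by
        simp [Fintype.sum_sum_type, sub_eq_add_neg]
    _ = ∑ l, ∑ᶠ p ∈ S, f l p + ∑ r, ∑ᶠ p ∈ S, -g r p := by
        rw [finsum_mem_sum_comm, Fintype.sum_sum_type]
        · rfl
        · rintro (l | r)
          · exact hf l
          · simpa only [Sum.elim_inr, Function.support_fun_neg] using hg r
    _ = ∑ l, ∑ᶠ p ∈ S, f l p - ∑ r, ∑ᶠ p ∈ S, g r p := by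
        simp only [finsum_neg_distrib, Finset.sum_neg_distrib, sub_eq_add_neg]

end FinsumMem

namespace MatchingDecomposition

open KDiagram

variable {k : Type u} [Field k] {W W' : ℤ × ℤ → ℤ} {d : ℤ × ℤ}

theorem finsum_mem_eq (D : MatchingDecomposition W) {S : Set (ℤ × ℤ)}
    (hS : ∀ M, IsPerfectMatching M → (S ∩ Function.support M).Finite) :
    ∑ᶠ p ∈ S, W p = ∑ r, ∑ᶠ p ∈ S, D.pos r p - ∑ r, ∑ᶠ p ∈ S, D.neg r p := by
  simp only [D.sum_eq]
  exact finsum_mem_sum_sub_sum (fun r => hS _ (D.pos_matching r))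
    fun r => hS _ (D.neg_matching r)

theorem isFredholm_virtual (D : MatchingDecomposition W) : (D.virtual k d).IsFredholm :=
  ⟨isFredholm_directSum_modelDiagram D.pos_matching,
    isFredholm_directSum_modelDiagram D.neg_matching⟩

theorem equivalent_virtual (D : MatchingDecomposition W) (D' : MatchingDecomposition W')
    (lower : ∑ᶠ p ∈ Set.Iic d, W p = ∑ᶠ p ∈ Set.Iic d, W' p)
    (upper : ∑ᶠ p ∈ Set.Ioi d.1 ×ˢ Set.Ioi d.2, W p = ∑ᶠ p ∈ Set.Ioi d.1 ×ˢ Set.Ioi d.2, W' p) :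
    (D.virtual k d).Equivalent (D'.virtual k d) := by
  have matching {K L : Type} {M : K → ℤ × ℤ → ℤ} {N : L → ℤ × ℤ → ℤ}
      (hM : ∀ r, IsPerfectMatching (M r)) (hN : ∀ r, IsPerfectMatching (N r)) :
      ∀ x, IsPerfectMatching (Sum.elim M N x) := Sum.rec hM hN
  have sum_eq {S : Set (ℤ × ℤ)} (hS : ∀ M, IsPerfectMatching M → (S ∩ Function.support M).Finite)
      (h : ∑ᶠ p ∈ S, W p = ∑ᶠ p ∈ S, W' p) :
      ∑ x, ∑ᶠ p ∈ S, Sum.elim D.pos D'.neg x p = ∑ x, ∑ᶠ p ∈ S, Sum.elim D'.pos D.neg x p := by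
    rw [D.finsum_mem_eq hS, D'.finsum_mem_eq hS] at h
    simp only [Fintype.sum_sum_type, Sum.elim_inl, Sum.elim_inr]
    linarith
  obtain ⟨φ⟩ := nonempty_iso_directSum_modelDiagram (k := k)
    (matching D.pos_matching D'.neg_matching) (matching D'.pos_matching D.neg_matching)
    (sum_eq (fun _ hM => finite_Iic_inter_support hM.1 d) lower)
    (sum_eq (fun _ hM => finite_Ioi_prod_inter_support hM.2.1 d) upper)
  refine ⟨D.isFredholm_virtual, D'.isFredholm_virtual, (D.virtual k d).plus,
    D.isFredholm_virtual.1, ⟨Iso.sumCongr ?_ (Iso.refl _)⟩⟩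
  exact (Iso.directSumSum fun x => modelDiagram k (Sum.elim D.pos D'.neg x) d).symm.trans
    (φ.trans (Iso.directSumSum fun x => modelDiagram k (Sum.elim D'.pos D.neg x) d))

theorem virtualClass_eq (D : MatchingDecomposition W) :
    virtualClass k W d = {V | V.Equivalent (D.virtual k d)} := by
  ext V
  exact ⟨fun ⟨D', h⟩ => h.trans (D'.equivalent_virtual D rfl rfl), fun h => ⟨D, h⟩⟩

theorem virtualClass_eq_virtualClass (D : MatchingDecomposition W)
    (D' : MatchingDecomposition W') (lower : ∑ᶠ p ∈ Set.Iic d, W p = ∑ᶠ p ∈ Set.Iic d, W' p)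
    (upper : ∑ᶠ p ∈ Set.Ioi d.1 ×ˢ Set.Ioi d.2, W p = ∑ᶠ p ∈ Set.Ioi d.1 ×ˢ Set.Ioi d.2, W' p) :
    virtualClass k W d = virtualClass k W' d := by
  have h : (D.virtual k d).Equivalent (D'.virtual k d) := D.equivalent_virtual D' lower upper
  rw [D.virtualClass_eq, D'.virtualClass_eq]
  ext V
  exact ⟨fun hV => hV.trans h, fun hV => hV.trans h.symm⟩

end MatchingDecomposition

/-! ### Decomposing regular matrices into permutation matrices -/

section RowSums

variable {α β : Type*} {M : Type*} [AddCommMonoid M]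

/-- All rows of the matrix `A` have finite support and sum `s`. As matrices may be infinite, column
sums are handled as the row sums of `fun b a => A a b`. -/
def HasRowSums (A : α → β → M) (s : M) : Prop :=
  ∀ a, (Function.support (A a)).Finite ∧ ∑ᶠ b, A a b = s

theorem HasRowSums.of_forall_ne {A : α → β → M} {s : M} (f : α → β) (h : ∀ a, A a (f a) = s)
    (h' : ∀ a b, b ≠ f a → A a b = 0) : HasRowSums A s := fun a =>
  ⟨(Set.finite_singleton (f a)).subset fun b hb => by_contra fun hne => hb (h' a b hne),
    (finsum_eq_single _ _ (h' a)).trans (h a)⟩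

theorem HasRowSums.add {A B : α → β → M} {s t : M} (hA : HasRowSums A s) (hB : HasRowSums B t) :
    HasRowSums (fun a b => A a b + B a b) (s + t) := fun a =>
  ⟨((hA a).1.union (hB a).1).subset (Function.support_add _ _), by
    rw [finsum_add_distrib (hA a).1 (hB a).1, (hA a).2, (hB a).2]⟩

theorem hasRowSums_strip (a b : ℤ) (c : M) :
    HasRowSums (fun i j : ℤ => if a < i + j ∧ i + j < b then c else 0)
      ((b - a - 1).toNat • c) := fun i => by
  have support_subset : (Function.support fun j => if a < i + j ∧ i + j < b then c else 0) ⊆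
      Finset.Ioo (a - i) (b - i) := fun j hj => by
    have := (ite_ne_right_iff.1 hj).1
    rw [Finset.coe_Ioo, Set.mem_Ioo]
    omega
  refine ⟨(Finset.finite_toSet _).subset support_subset, ?_⟩
  rw [finsum_eq_sum_of_support_subset _ support_subset, Finset.sum_congr rfl fun j hj => if_pos ?_,
    Finset.sum_const, Int.card_Ioo]
  · congr 2
    ring
  · rw [Finset.mem_Ioo] at hj
    omega

end RowSums

namespace HasRowSums

variable {α β : Type*} {A : α → β → ℕ} {s t : ℕ}

theorem sum_le (h : HasRowSums A s) (a : α) (Y : Finset β) : ∑ b ∈ Y, A a b ≤ s := by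
  rw [← (h a).2, finsum_eq_sum _ (h a).1]
  exact Finset.sum_le_sum_of_ne_zero fun b _ hb => (h a).1.mem_toFinset.2 hb

theorem sum_eq (h : HasRowSums A s) {a : α} {Y : Finset β} (hY : Function.support (A a) ⊆ Y) :
    ∑ b ∈ Y, A a b = s := by
  rw [← (h a).2, finsum_eq_sum_of_support_subset _ hY]

theorem of_intCast (h : HasRowSums (fun a b => (A a b : ℤ)) s) : HasRowSums A s := fun a => by
  have hA : (Function.support (A a)).Finite := by simpa [Function.support] using (h a).1
  refine ⟨hA, Nat.cast_injective (R := ℤ) ?_⟩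
  rw [← (h a).2]
  exact (Nat.castAddMonoidHom ℤ).map_finsum hA

theorem of_add {P : α → β → ℕ} (h : HasRowSums (fun a b => A a b + P a b) (s + t))
    (hP : HasRowSums P t) : HasRowSums A s := fun a => by
  have hA : (Function.support (A a)).Finite :=
    (h a).1.subset fun b hb => by simp at hb ⊢; omega
  have sum_add := (h a).2
  rw [finsum_add_distrib hA (hP a).1, (hP a).2] at sum_add
  exact ⟨hA, add_right_cancel sum_add⟩

theorem exists_injective (h : HasRowSums A (s + 1))
    (h' : HasRowSums (fun b a => A a b) (s + 1)) :
    ∃ f : α → β, Function.Injective f ∧ ∀ a, A a (f a) ≠ 0 := by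
  classical
  let N (a : α) : Finset β := (h a).1.toFinset
  have hall : ∀ X : Finset α, X.card ≤ (X.biUnion N).card := fun X => by
    have support_subset : ∀ a ∈ X, Function.support (A a) ⊆ X.biUnion N := fun a ha b hb =>
      Finset.mem_biUnion.2 ⟨a, ha, (h a).1.mem_toFinset.2 hb⟩
    refine Nat.le_of_mul_le_mul_right ?_ s.succ_pos
    calc X.card * (s + 1) = ∑ a ∈ X, ∑ b ∈ X.biUnion N, A a b := by
          rw [Finset.sum_congr rfl fun a ha => h.sum_eq (support_subset a ha), Finset.sum_const,
            smul_eq_mul]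
      _ = ∑ b ∈ X.biUnion N, ∑ a ∈ X, A a b := Finset.sum_comm
      _ ≤ (X.biUnion N).card * (s + 1) :=
          (Finset.sum_le_card_nsmul _ _ _ fun b _ => h'.sum_le b X)
  obtain ⟨f, hf, hfN⟩ := (Finset.all_card_le_biUnion_card_iff_exists_injective N).1 hall
  exact ⟨f, hf, fun a => (h a).1.mem_toFinset.1 (hfN a)⟩

theorem exists_equiv (h : HasRowSums A (s + 1)) (h' : HasRowSums (fun b a => A a b) (s + 1)) :
    ∃ π : α ≃ β, ∀ a, A a (π a) ≠ 0 := by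
  obtain ⟨f, hf, hAf⟩ := h.exists_injective h'
  obtain ⟨g, hg, hAg⟩ := h'.exists_injective h
  obtain ⟨π, hπ, hAπ⟩ :=
    Function.Embedding.schroeder_bernstein_of_rel hf hg (fun a b => A a b ≠ 0) hAf hAg
  exact ⟨Equiv.ofBijective π hπ, hAπ⟩

theorem exists_eq_sum_permutations [DecidableEq β] (h : HasRowSums A s)
    (h' : HasRowSums (fun b a => A a b) s) :
    ∃ π : Fin s → α ≃ β, ∀ a b, A a b = ∑ r, if b = π r a then 1 else 0 := by
  induction s generalizing A with
  | zero =>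
    refine ⟨finZeroElim, fun a b => ?_⟩
    simpa using h.sum_le a {b}
  | succ s ih =>
    obtain ⟨π, hπ⟩ := h.exists_equiv h'
    let P (a : α) (b : β) : ℕ := if b = π a then 1 else 0
    let B (a : α) (b : β) : ℕ := A a b - P a b
    have hB : ∀ a b, B a b + P a b = A a b := fun a b => by
      refine Nat.sub_add_cancel ?_
      by_cases hb : b = π a
      · simpa [P, hb, Nat.one_le_iff_ne_zero] using hπ a
      · simp [P, hb]
    have hP : HasRowSums P 1 := .of_forall_ne π (by simp [P]) (by simp +contextual [P])
    have hP' : HasRowSums (fun b a => P a b) 1 :=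
      .of_forall_ne π.symm (by simp [P]) (by simp +contextual [P, Equiv.eq_symm_apply, eq_comm])
    obtain ⟨ρ, hρ⟩ := ih (A := B) (of_add (by simpa only [hB] using h) hP)
      (of_add (by simpa only [hB] using h') hP')
    refine ⟨Fin.snoc ρ π, fun a b => ?_⟩
    rw [← hB, hρ, Fin.sum_univ_castSucc]
    simp only [Fin.snoc_castSucc, Fin.snoc_last, P]

end HasRowSums

/-- `A : ℤ² → ℤ` vanishes outside a strip `a < deg < b`, and all its rows and columns have sum `s`.
The perfect matchings are the `0`-`1`-valued such functions with `s = 1`. -/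
structure IsStripRegular (A : ℤ × ℤ → ℤ) (s : ℤ) : Prop where
  initially : InitiallyZero A
  eventually : EventuallyZero A
  rows : HasRowSums (fun i j => A (i, j)) s
  cols : HasRowSums (fun j i => A (i, j)) s

theorem IsStripRegular.add {A B : ℤ × ℤ → ℤ} {s t : ℤ} (hA : IsStripRegular A s)
    (hB : IsStripRegular B t) : IsStripRegular (fun p => A p + B p) (s + t) := by
  obtain ⟨⟨a, ha⟩, ⟨b, hb⟩, rows, cols⟩ := hA
  obtain ⟨⟨a', ha'⟩, ⟨b', hb'⟩, rows', cols'⟩ := hB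
  refine ⟨⟨min a a', fun p hp => ?_⟩, ⟨max b b', fun p hp => ?_⟩, rows.add rows', cols.add cols'⟩
  · simp only [ha p (hp.trans (min_le_left _ _)), ha' p (hp.trans (min_le_right _ _)), add_zero]
  · simp only [hb p ((le_max_left _ _).trans hp), hb' p ((le_max_right _ _).trans hp), add_zero]

/-- The function on `ℤ²` with value `c` on the strip `a < deg < b`, and `0` elsewhere. -/
def stripConst (a b c : ℤ) (p : ℤ × ℤ) : ℤ := if a < p.1 + p.2 ∧ p.1 + p.2 < b then c else 0

theorem isStripRegular_stripConst (a b c : ℤ) :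
    IsStripRegular (stripConst a b c) ((b - a - 1).toNat * c) := by
  have rows : HasRowSums (fun i j => stripConst a b c (i, j)) ((b - a - 1).toNat * c) := by
    simpa only [stripConst, nsmul_eq_mul] using hasRowSums_strip a b c
  refine ⟨⟨a, fun p hp => if_neg fun h => h.1.not_ge hp⟩,
    ⟨b, fun p hp => if_neg fun h => h.2.not_ge hp⟩, rows, ?_⟩
  simpa only [stripConst, add_comm] using rows

theorem IsStripRegular.exists_eq_sum_perfectMatchings {A : ℤ × ℤ → ℤ} {s : ℕ}
    (hA : IsStripRegular A s) (nonneg : ∀ p, 0 ≤ A p) :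
    ∃ M : Fin s → ℤ × ℤ → ℤ, (∀ r, IsPerfectMatching (M r)) ∧ ∀ p, A p = ∑ r, M r p := by
  obtain ⟨π, hπ⟩ := HasRowSums.exists_eq_sum_permutations (A := fun i j => (A (i, j)).toNat)
    (.of_intCast (by simpa only [Int.toNat_of_nonneg (nonneg _)] using hA.rows))
    (.of_intCast (by simpa only [Int.toNat_of_nonneg (nonneg _)] using hA.cols))
  let M (r : Fin s) (p : ℤ × ℤ) : ℤ := if p.2 = π r p.1 then 1 else 0
  have sum_eq (p : ℤ × ℤ) : A p = ∑ r, M r p := by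
    rw [← Int.toNat_of_nonneg (nonneg p), hπ p.1 p.2]
    simp [M]
  have eq_zero {p : ℤ × ℤ} (hp : A p = 0) (r : Fin s) : M r p = 0 := by
    have M_nonneg : ∀ r ∈ Finset.univ, 0 ≤ M r p := fun r _ => by
      dsimp only [M]
      split_ifs <;> decide
    exact (Finset.sum_eq_zero_iff_of_nonneg M_nonneg).1 ((sum_eq p).symm.trans hp) r
      (Finset.mem_univ r)
  obtain ⟨a, ha⟩ := hA.initially
  obtain ⟨b, hb⟩ := hA.eventually
  exact ⟨M, fun r => ⟨⟨a, fun p hp => eq_zero (ha p hp) r⟩, ⟨b, fun p hp => eq_zero (hb p hp) r⟩,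
    π r, fun _ _ => rfl⟩, sum_eq⟩

theorem IsStripRegular.nonempty_matchingDecomposition {W : ℤ × ℤ → ℤ} (hW : IsStripRegular W 1)
    (bounded : IsBoundedWeight W) : Nonempty (MatchingDecomposition W) := by
  obtain ⟨c, hc⟩ := bounded
  obtain ⟨a, ha⟩ := hW.initially
  obtain ⟨b, hb⟩ := hW.eventually
  have c_nonneg : 0 ≤ c := (abs_nonneg _).trans (hc (0, 0))
  have add_nonneg (p : ℤ × ℤ) : 0 ≤ stripConst a b c p + W p := by
    rw [stripConst]
    split_ifs with hp
    · linarith [(abs_le.1 (hc p)).1]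
    · have : W p = 0 := by
        by_cases hpa : p.1 + p.2 ≤ a
        · exact ha p hpa
        · exact hb p (by omega)
      rw [this, add_zero]
  obtain ⟨m, hm⟩ := Int.eq_ofNat_of_zero_le (mul_nonneg (Int.natCast_nonneg (b - a - 1).toNat)
    c_nonneg)
  have hB : IsStripRegular (stripConst a b c) m := hm ▸ isStripRegular_stripConst a b c
  have B_nonneg (p : ℤ × ℤ) : 0 ≤ stripConst a b c p := ite_nonneg c_nonneg le_rfl
  obtain ⟨neg, neg_matching, neg_sum⟩ := hB.exists_eq_sum_perfectMatchings B_nonneg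
  have hA : IsStripRegular (fun p => stripConst a b c p + W p) (m + 1 : ℕ) := by
    exact_mod_cast hB.add hW
  obtain ⟨pos, pos_matching, pos_sum⟩ := hA.exists_eq_sum_perfectMatchings add_nonneg
  exact ⟨⟨m, pos, neg, pos_matching, neg_matching, fun p => by
    rw [← pos_sum, ← neg_sum, add_sub_cancel_left]⟩⟩

theorem IsPerfectMatching.abs_le_one {W : ℤ × ℤ → ℤ} (hW : IsPerfectMatching W) (p : ℤ × ℤ) :
    |W p| ≤ 1 := by
  rw [hW.apply_eq]
  split_ifs <;> simp

theorem MatchingDecomposition.isBoundedWeight {W : ℤ × ℤ → ℤ} (D : MatchingDecomposition W) :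
    IsBoundedWeight W := by
  have abs_sum_le {n : ℕ} {M : Fin n → ℤ × ℤ → ℤ} (hM : ∀ r, IsPerfectMatching (M r))
      (p : ℤ × ℤ) : |∑ r, M r p| ≤ n := by
    simpa using (Finset.abs_sum_le_sum_abs _ _).trans
      (Finset.sum_le_card_nsmul Finset.univ _ 1 fun r _ => (hM r).abs_le_one p)
  refine ⟨(D.m + 1 : ℕ) + D.m, fun p => ?_⟩
  rw [D.sum_eq]
  exact (abs_sub _ _).trans
    (add_le_add (abs_sum_le D.pos_matching p) (abs_sum_le D.neg_matching p))

/-! ### Weights of Riemann functions -/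

section Telescope

variable {M : Type*} [AddCommGroup M]

theorem sum_Ioc_sub_sub_one (h : ℤ → M) {a b : ℤ} (hab : a ≤ b) :
    ∑ x ∈ Finset.Ioc a b, (h x - h (x - 1)) = h b - h a := by
  induction b, hab using Int.leInduction with
  | base => simp
  | succ b hab ih =>
    rw [← Finset.insert_Ioc_right_eq_Ioc_add_one hab, Finset.sum_insert (by simp), ih]
    simp

open Filter in
theorem hasRowSums_sub_sub_one {ι : Type*} {h : ι → ℤ → M} {c : M}
    (h_bot : ∀ i, ∀ᶠ x in atBot, h i x = 0) (h_top : ∀ i, ∀ᶠ x in atTop, h i x = c) :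
    HasRowSums (fun i x => h i x - h i (x - 1)) c := fun i => by
  obtain ⟨a, ha⟩ := eventually_atBot.1 (h_bot i)
  obtain ⟨b, hb⟩ := eventually_atTop.1 ((h_top i).and (eventually_ge_atTop a))
  have support_subset : (Function.support fun x => h i x - h i (x - 1)) ⊆
      Finset.Ioc a (b + 1) := fun x hx => by
    rw [Finset.coe_Ioc, Set.mem_Ioc]
    by_contra hx'
    rcases le_or_gt x a with hxa | hxa
    · exact hx (by simp only [ha x hxa, ha (x - 1) (by omega), sub_zero])
    · exact hx (by simp only [(hb x (by omega)).1, (hb (x - 1) (by omega)).1, sub_self])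
  refine ⟨(Finset.finite_toSet _).subset support_subset, ?_⟩
  rw [finsum_eq_sum_of_support_subset _ support_subset,
    sum_Ioc_sub_sub_one _ ((hb b le_rfl).2.trans (by omega)), (hb (b + 1) (by omega)).1,
    ha a le_rfl, sub_zero]

end Telescope

/-- The Riemann functions of two variables, as functions on `ℤ × ℤ`, with constant `C`. -/
def IsPlanarRiemann (g : ℤ × ℤ → ℤ) (C : ℤ) : Prop :=
  InitiallyZero g ∧ EventuallyZero fun p => g p - (p.1 + p.2 + C)

/-- The Serre dual of a Riemann function `g` with constant `C`: if `g` is the dimension of `H⁰` and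
`deg + C` the Euler characteristic, it is the dimension of `H¹` at `-p`. -/
def serreDual (g : ℤ × ℤ → ℤ) (C : ℤ) (p : ℤ × ℤ) : ℤ := g (-p) + p.1 + p.2 - C

theorem weight_serreDual (g : ℤ × ℤ → ℤ) (C : ℤ) (p : ℤ × ℤ) :
    weight (serreDual g C) p = weight g ((1, 1) - p) := by
  obtain ⟨x, y⟩ := p
  have neg_sub_one (x : ℤ) : -(x - 1) = 1 - x := neg_sub x 1
  have one_sub_sub_one (x : ℤ) : 1 - x - 1 = -x := by ring
  simp only [weight, serreDual, Prod.neg_mk, Prod.mk_sub_mk, neg_sub_one, one_sub_sub_one]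
  ring

theorem weight_swap (g : ℤ × ℤ → ℤ) (p : ℤ × ℤ) :
    weight (fun q => g q.swap) p = weight g p.swap := by
  simp only [weight, Prod.swap]
  ring

namespace IsPlanarRiemann

variable {g : ℤ × ℤ → ℤ} {C : ℤ}

theorem swap (hg : IsPlanarRiemann g C) : IsPlanarRiemann (fun p => g p.swap) C := by
  obtain ⟨⟨a, ha⟩, b, hb⟩ := hg
  refine ⟨⟨a, fun p hp => ha p.swap (by rwa [add_comm])⟩, b, fun p hp => ?_⟩
  simpa only [Prod.fst_swap, Prod.snd_swap, add_comm] using hb p.swap (by rwa [add_comm])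

theorem initiallyZero_serreDual (hg : IsPlanarRiemann g C) : InitiallyZero (serreDual g C) := by
  obtain ⟨-, b, hb⟩ := hg
  refine ⟨-b, fun p hp => ?_⟩
  have := hb (-p) (by simp only [Prod.fst_neg, Prod.snd_neg]; omega)
  simp only [Prod.fst_neg, Prod.snd_neg] at this
  simp only [serreDual]
  linarith

theorem initiallyZero_weight (hg : IsPlanarRiemann g C) : InitiallyZero (weight g) :=
  ((isWeight_iff hg.1 _).2 rfl).1

theorem finsum_mem_Iic_weight (hg : IsPlanarRiemann g C) (d : ℤ × ℤ) :
    ∑ᶠ p ∈ Set.Iic d, weight g p = g d :=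
  (((isWeight_iff hg.1 _).2 rfl).2 d).symm

theorem eventuallyZero_weight (hg : IsPlanarRiemann g C) : EventuallyZero (weight g) := by
  obtain ⟨a, ha⟩ := ((isWeight_iff hg.initiallyZero_serreDual _).2 rfl).1
  refine ⟨2 - a, fun p hp => ?_⟩
  have := ha ((1, 1) - p) (by simp only [Prod.fst_sub, Prod.snd_sub]; omega)
  rwa [weight_serreDual, sub_sub_cancel] at this

theorem finsum_mem_Ioi_prod_weight (hg : IsPlanarRiemann g C) (d : ℤ × ℤ) :
    ∑ᶠ p ∈ Set.Ioi d.1 ×ˢ Set.Ioi d.2, weight g p = g d - (d.1 + d.2 + C) := by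
  have reflect : Set.BijOn (fun p : ℤ × ℤ => (1, 1) - p) (Set.Ioi d.1 ×ˢ Set.Ioi d.2)
      (Set.Iic (-d)) := by
    refine ⟨fun p hp => ?_, (sub_right_injective (b := ((1, 1) : ℤ × ℤ))).injOn,
      fun q hq => ⟨(1, 1) - q, ?_, sub_sub_cancel _ _⟩⟩
    all_goals
      simp only [Set.mem_prod, Set.mem_Ioi, Set.mem_Iic, Prod.le_def, Prod.fst_sub, Prod.snd_sub,
        Prod.fst_neg, Prod.snd_neg] at *
      omega
  calc ∑ᶠ p ∈ Set.Ioi d.1 ×ˢ Set.Ioi d.2, weight g p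
      = ∑ᶠ p ∈ Set.Iic (-d), weight (serreDual g C) p :=
        finsum_mem_eq_of_bijOn _ reflect fun p _ => by rw [weight_serreDual, sub_sub_cancel]
    _ = serreDual g C (-d) := ((isWeight_iff hg.initiallyZero_serreDual _).2 rfl).2 _ |>.symm
    _ = g d - (d.1 + d.2 + C) := by
        simp only [serreDual, neg_neg, Prod.fst_neg, Prod.snd_neg]
        ring

open Filter in
theorem hasRowSums_weight (hg : IsPlanarRiemann g C) :
    HasRowSums (fun i j => weight g (i, j)) 1 := by
  obtain ⟨⟨a, ha⟩, b, hb⟩ := hg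
  have weight_eq (i j : ℤ) :
      weight g (i, j) = g (i, j) - g (i - 1, j) - (g (i, j - 1) - g (i - 1, j - 1)) := by
    simp only [weight]
    ring
  simp only [weight_eq]
  refine hasRowSums_sub_sub_one (h := fun i j => g (i, j) - g (i - 1, j)) (fun i => ?_) fun i => ?_
  · filter_upwards [eventually_le_atBot (a - i)] with j hj
    rw [ha (i, j) (by simp only; omega), ha (i - 1, j) (by simp only; omega), sub_zero]
  · filter_upwards [eventually_ge_atTop (b - i + 1)] with j hj
    linarith [hb (i, j) (by simp only; omega), hb (i - 1, j) (by simp only; omega)]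

theorem isStripRegular_weight (hg : IsPlanarRiemann g C) : IsStripRegular (weight g) 1 where
  initially := hg.initiallyZero_weight
  eventually := hg.eventuallyZero_weight
  rows := hg.hasRowSums_weight
  cols := by simpa only [weight_swap, Prod.swap_prod_mk] using hg.swap.hasRowSums_weight

theorem virtualClass_weight_eq (k : Type u) [Field k] {g' : ℤ × ℤ → ℤ} {d : ℤ × ℤ}
    (hg : IsPlanarRiemann g C) (hg' : IsPlanarRiemann g' C) (h : g d = g' d)
    (bounded : IsBoundedWeight (weight g)) (bounded' : IsBoundedWeight (weight g')) :
    virtualClass k (weight g) d = virtualClass k (weight g') d := by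
  obtain ⟨D⟩ := hg.isStripRegular_weight.nonempty_matchingDecomposition bounded
  obtain ⟨D'⟩ := hg'.isStripRegular_weight.nonempty_matchingDecomposition bounded'
  refine D.virtualClass_eq_virtualClass D' ?_ ?_
  · rw [hg.finsum_mem_Iic_weight, hg'.finsum_mem_Iic_weight, h]
  · rw [hg.finsum_mem_Ioi_prod_weight, hg'.finsum_mem_Ioi_prod_weight, h]

end IsPlanarRiemann

section Restriction

variable {n : ℕ} {f : (Fin n → ℤ) → ℤ}

theorem vecDeg_add_single_add_single (d : Fin n → ℤ) (i j : Fin n) (x y : ℤ) :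
    vecDeg (d + Pi.single i x + Pi.single j y) = vecDeg d + x + y := by
  simp [vecDeg, Finset.sum_add_distrib]

theorem twoVar_zero (f : (Fin n → ℤ) → ℤ) (i j : Fin n) (d : Fin n → ℤ) :
    twoVar f i j d (0, 0) = f d := by
  simp [twoVar]

theorem IsRiemann.exists_isPlanarRiemann_twoVar (hf : IsRiemann f) (d : Fin n → ℤ) :
    ∃ C, ∀ i j, IsPlanarRiemann (twoVar f i j d) C := by
  obtain ⟨C, a, b, ha, hb⟩ := hf
  refine ⟨vecDeg d + C, fun i j => ⟨⟨a - vecDeg d, fun p hp => ha _ ?_⟩, b - vecDeg d,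
    fun p hp => ?_⟩⟩
  · rw [vecDeg_add_single_add_single]
    linarith
  · have hdeg : b ≤ vecDeg (d + Pi.single i p.1 + Pi.single j p.2) := by
      rw [vecDeg_add_single_add_single]
      linarith
    simp only [twoVar, hb _ hdeg, vecDeg_add_single_add_single]
    ring

theorem IsRiemann.nonempty_matchingDecomposition (hf : IsRiemann f) (i j : Fin n)
    (d : Fin n → ℤ) (bounded : IsBoundedWeight (restrictionWeight f i j d)) :
    Nonempty (MatchingDecomposition (restrictionWeight f i j d)) := by
  obtain ⟨C, hC⟩ := hf.exists_isPlanarRiemann_twoVar d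
  exact (hC i j).isStripRegular_weight.nonempty_matchingDecomposition bounded

theorem IsRiemann.restrictionClass_eq (k : Type u) [Field k] (hf : IsRiemann f) (d : Fin n → ℤ)
    {i j i' j' : Fin n} (bounded : IsBoundedWeight (restrictionWeight f i j d))
    (bounded' : IsBoundedWeight (restrictionWeight f i' j' d)) :
    restrictionClass k f i j d = restrictionClass k f i' j' d := by
  obtain ⟨C, hC⟩ := hf.exists_isPlanarRiemann_twoVar d
  exact (hC i j).virtualClass_weight_eq k (hC i' j') (by rw [twoVar_zero, twoVar_zero])
    bounded bounded'

end Restriction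

theorem mainTheorem5 (k : Type u) [Field k] {n : ℕ} (f : (Fin n → ℤ) → ℤ) (hf : IsRiemann f)
    (d : Fin n → ℤ) :
    -- the class is defined exactly for bounded weights, and is then a single equivalence class
    (∀ i j : Fin n, i ≠ j →
      (Nonempty (MatchingDecomposition (restrictionWeight f i j d)) ↔
        IsBoundedWeight (restrictionWeight f i j d)) ∧
      ∀ D : MatchingDecomposition (restrictionWeight f i j d),
        D.virtual k (0, 0) ∈ restrictionClass k f i j d ∧
        restrictionClass k f i j d = {V | V.Equivalent (D.virtual k (0, 0))}) ∧
    -- three distinct indices (so that `n ≥ 3`)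
    (∀ i j j' : Fin n, i ≠ j → i ≠ j' → j ≠ j' →
      IsBoundedWeight (restrictionWeight f i j d) →
      IsBoundedWeight (restrictionWeight f i j' d) →
      restrictionClass k f i j d = restrictionClass k f i j' d) ∧
    -- independence of the pair of distinct indices (so that `n ≥ 2`)
    (∀ i j i' j' : Fin n, i ≠ j → i' ≠ j' →
      IsBoundedWeight (restrictionWeight f i j d) →
      IsBoundedWeight (restrictionWeight f i' j' d) →
      restrictionClass k f i j d = restrictionClass k f i' j' d) := by
  refine ⟨fun i j _ => ⟨⟨fun ⟨D⟩ => D.isBoundedWeight,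
    hf.nonempty_matchingDecomposition i j d⟩, fun D => ⟨?_, D.virtualClass_eq⟩⟩,
    fun _ _ _ _ _ _ h h' => hf.restrictionClass_eq k d h h',
    fun _ _ _ _ _ _ h h' => hf.restrictionClass_eq k d h h'⟩
  exact ⟨D, D.equivalent_virtual D rfl rfl⟩
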